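/- Let $\mathbb K$ be a field, $R=\mathbb K[x_0,\dots,x_n]$ with $x_0<\dots<x_n$, $R_A=A[x_0,\dots,x_n]$ for a Noetherian $\mathbb K$-algebra $A$, and $\boldsymbol d\in\mathbb Z^m$; $R_A^m(-\boldsymbol d)$ is the graded free module with basis $\mathsf e_1,\dots,\mathsf e_m$, $\deg \mathsf e_k=d_k$. A term $x^\alpha\mathsf e_k$ has *multiplicative variables* $x_i\le\min(x^\alpha)$, the smallest variable dividing $x^\alpha$ (all variables if $x^\alpha=1$; in this case put $\min(x^\alpha)=x_n$); its *Pommaret cone* is the set of its multiples by products of multiplicative variables. A submodule $U\subseteq R^m(-\boldsymbol d)$ is *quasi-stable* if it is generated by a finite set $\mathcal P_U$ of terms (its Pommaret basis) whose Pommaret cones partition the set of terms in $U$; $\mathcal N(U)$ is the set of terms not in $U$, and $\langle\mathcal N(U)\rangle$ is the $A$-module generated by it. Let $U$ be quasi-stable. A *$U$-marked basis* over $A$ is a family $F=(F_a)_{a\in\mathcal P_U}$ in $R_A^m(-\boldsymbol d)$, with $F_a$ homogeneous of degree $\deg a$, such that $a$ has coefficient $1$ in $F_a$, all other terms of $F_a$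 lie in $\mathcal N(U)$, and $R_A^m(-\boldsymbol d)=(F)\oplus\langle\mathcal N(U)\rangle$. Its syzygy module is the kernel of $\bigoplus_{a\in\mathcal P_U}R_A(-\deg a)\,\mathsf f_a\to R_A^m(-\boldsymbol d)$, $\mathsf f_a\mapsto F_a$. Its *fundamental syzygies* are the elements $x_i\mathsf f_a-\sum_c Q_c\mathsf f_c$, for $a\in\mathcal P_U$ and $x_i$ a non-multiplicative variable of $a$, where $x_iF_a=\sum_cQ_cF_c$ with each $Q_c\in R_A$ involving only multiplicative variables of $c$. Put $U^{(0)}=U$, and let $U^{(t+1)}$ be the stable module with Pommaret basis $\{x_i\mathsf f_a \mid a\in\mathcal P_{U^{(t)}},\ x_i \text{ non-multiplicative for } a\}$ in the graded free module with basis $(\mathsf f_a)_{a\in\mathcal P_{U^{(t)}}}$, $\deg\mathsf f_a=\deg a$. If $M$ is generated by a $U$-marked basis $F$, let $F^{\partial_0}=F$ and let $F^{\partial_{t+1}}$ be the family of fundamental syzygies of the $U^{(t)}$-marked basis $F^{\partial_t}$. Let $D$ be the smallest index of a variable $\min(x^\alpha)$ with $x^\alpha\mathsf e_k\in\mathcal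 P_U$ ($D=n$ if $U=0$). Consider the following functors from Noetherian $\mathbb K$-algebras to sets, on which morphisms act by extension of scalars: * $\underline{\mathrm{Mf}}_U(A)=\{M\subseteq R_A^m(-\boldsymbol d)\text{ graded submodule}\mid M\oplus\langle\mathcal N(U)\rangle=R_A^m(-\boldsymbol d)\}$; * $\underline{\mathrm{MSyz}}_U(A)$: the pairs $(M,S_1)$ with $M\in\underline{\mathrm{Mf}}_U(A)$ and $S_1$ the syzygy module of the $U$-marked basis of $M$; * $\underline{\mathrm{MRes}}_U(A)$: the tuples $(M,S_1,\dots,S_{n-D})$ with $M\in\underline{\mathrm{Mf}}_U(A)$ and $S_t$ the syzygy module of $F^{\partial_{t-1}}$ for $1\le t\le n-D$, where $F$ is the $U$-marked basis of $M$. Let $\mathbb K[C]$ be the polynomial ring in the parameters $C_a^b$, $a\in\mathcal P_U$, $b\in\mathcal N(U)$, $\deg b=\deg a$; put $\mathcal F_a=a-\sum_bC_a^b\,b$, and let $\mathscr U\subseteq\mathbb K[C]$ be the ideal generated by the coefficients of all $g\in\langle\mathcal N(U)\rangle$ occurring in the unique writings $x_i\mathcal F_a=\sum_cQ_c\mathcal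 F_c+g$, with $x_i$ non-multiplicative for $a$ and each $Q_c$ involving only multiplicative variables of $c$. Let $\mathbf{Mf}_U=\mathrm{Spec}(\mathbb K[C]/\mathscr U)$. A $\mathbb K$-scheme $Y$ represents a functor $\Phi$ if $A\mapsto\mathrm{Hom}_{\mathbb K}(\mathrm{Spec}\,A,Y)$, on Noetherian $\mathbb K$-algebras, is naturally isomorphic to $\Phi$. Then the projections $(M,S_1)\mapsto M$ and $(M,S_1,\dots,S_{n-D})\mapsto M$ are natural isomorphisms $\underline{\mathrm{MSyz}}_U\to\underline{\mathrm{Mf}}_U$ and $\underline{\mathrm{MRes}}_U\to\underline{\mathrm{Mf}}_U$. Moreover $\mathbf{Mf}_U$ is locally Noetherian and represents $\underline{\mathrm{Mf}}_U$. Consequently $\underline{\mathrm{MSyz}}_U$ and $\underline{\mathrm{MRes}}_U$ are representable by locally Noetherian $\mathbb K$-schemes, and every locally Noetherian $\mathbb K$-scheme representing one of them is isomorphic over $\mathbb K$ to $\mathbf{Mf}_U$. -/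

import Mathlib

open CategoryTheory AlgebraicGeometry

universe u

namespace MarkedSyz

/-! ### Terms, Pommaret cones and quasi-stable modules -/

/-- The polynomial ring `A[x_0, …, x_n]`; the variables are ordered by `x_0 < ⋯ < x_n`. -/
abbrev Poly (n : ℕ) (A : Type*) [CommRing A] : Type _ := MvPolynomial (Fin (n + 1)) A

/-- A term `x^α e_k` of a free module with basis `(e_k)_{k ∈ ι}`, given as the pair `(k, α)`. -/
abbrev Term (n : ℕ) (ι : Type*) : Type _ := ι × (Fin (n + 1) →₀ ℕ)

open Classical in
/-- The term `x^α e_k` as an element of the free module `A[x_0, …, x_n]^ι`. -/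
noncomputable def term {n : ℕ} {ι : Type*} (A : Type*) [CommRing A] (t : Term n ι) :
    ι → Poly n A :=
  fun k => if k = t.1 then MvPolynomial.monomial t.2 1 else 0

/-- The index of the smallest variable dividing `x^α`; by convention it is `n` for `x^α = 1`,
so that in all cases the multiplicative variables of `x^α` are the `x_i` with `i ≤ minVar α`. -/
noncomputable def minVar {n : ℕ} (α : Fin (n + 1) →₀ ℕ) : Fin (n + 1) := α.support.inf id

/-- The Pommaret cone of a term. -/
def cone {n : ℕ} {ι : Type*} (t : Term n ι) : Set (Term n ι) :=
  {s | s.1 = t.1 ∧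
    ∃ δ : Fin (n + 1) →₀ ℕ, (∀ i, δ i ≠ 0 → i ≤ minVar t.2) ∧ s.2 = δ + t.2}

/-- `P` is a finite Pommaret basis of the (then monomial) submodule `U` of `K[x_0, …, x_n]^ι`. -/
def IsPommaretBasis {K : Type*} [Field K] {n : ℕ} {ι : Type*}
    (U : Submodule (Poly n K) (ι → Poly n K)) (P : Finset (Term n ι)) : Prop :=
  Submodule.span (Poly n K) (term K '' (P : Set (Term n ι))) = U ∧
  {t : Term n ι | term K t ∈ U} = ⋃ p ∈ P, cone p ∧
  (P : Set (Term n ι)).PairwiseDisjoint cone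

/-- A quasi-stable module: a monomial module with a finite Pommaret basis. -/
def IsQuasiStable {K : Type*} [Field K] {n : ℕ} {ι : Type*}
    (U : Submodule (Poly n K) (ι → Poly n K)) : Prop :=
  ∃ P : Finset (Term n ι), IsPommaretBasis U P

/-- The degree of the term `x^α e_k` in the graded free module `⨁ₖ R(-d_k) e_k`. -/
noncomputable def termDegree {n : ℕ} {ι : Type*} (d : ι → ℤ) (t : Term n ι) : ℤ := (t.2.degree : ℤ) + d t.1

/-- `f` is homogeneous of degree `s` in `⨁ₖ R_A(-d_k) e_k`. -/
def IsHomog {n : ℕ} {ι A : Type*} [CommRing A] (d : ι → ℤ) (s : ℤ) (f : ι → Poly n A) : Prop :=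
  ∀ t : Term n ι, MvPolynomial.coeff t.2 (f t.1) ≠ 0 → termDegree d t = s

/-- `M` is a graded submodule of `⨁ₖ R_A(-d_k) e_k`: it is generated by homogeneous elements. -/
def IsGraded {n : ℕ} {ι A : Type*} [CommRing A] (d : ι → ℤ)
    (M : Submodule (Poly n A) (ι → Poly n A)) : Prop :=
  Submodule.span (Poly n A) {f | f ∈ M ∧ ∃ s, IsHomog d s f} = M

/-- A quasi-stable submodule `U` of a graded free module `⨁ₖ R(-d_k) e_k` of finite rank over
`R = K[x_0, …, x_n]`, together with its (unique) Pommaret basis `P`. -/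
structure QSModule (K : Type u) [Field K] (n : ℕ) where
  ι : Type
  [finite_ι : Finite ι]
  d : ι → ℤ
  U : Submodule (Poly n K) (ι → Poly n K)
  P : Finset (Term n ι)
  isPommaretBasis : IsPommaretBasis U P

attribute [instance] QSModule.finite_ι

/-- The quasi-stable submodule `U` of `R^m(-d)` with its Pommaret basis. -/
noncomputable def IsQuasiStable.toQSModule {K : Type u} [Field K] {n m : ℕ}
    {U : Submodule (Poly n K) (Fin m → Poly n K)} (hU : IsQuasiStable U) (d : Fin m → ℤ) :
    QSModule K n where
  ι := Fin m
  d := d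
  U := U
  P := hU.choose
  isPommaretBasis := hU.choose_spec

/-! ### The stable modules `U^(t)` -/

section Next

variable {K : Type u} [Field K] {n : ℕ}

theorem minVar_single (i : Fin (n + 1)) : minVar (Finsupp.single i 1) = i := by
  simp [minVar]

/-- The terms `x_i f_a`, where `a ∈ P_U` and `x_i` is a non-multiplicative variable of `a`, of the
free module with basis `(f_a)_{a ∈ P_U}`. -/
noncomputable def nextBasis {ι : Type} (P : Finset (Term n ι)) : Finset (Term n P) :=
  ((Finset.univ : Finset (P × Fin (n + 1))).filter fun q => minVar q.1.1.2 < q.2).map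
    ⟨fun q => (q.1, Finsupp.single q.2 1), fun p q h => by
      have h1 := (Prod.ext_iff.1 h).1
      have h2 := (Prod.ext_iff.1 h).2
      exact Prod.ext h1 (Finsupp.single_left_injective one_ne_zero h2)⟩

theorem mem_nextBasis {ι : Type} {P : Finset (Term n ι)} {t : Term n P} :
    t ∈ nextBasis P ↔ ∃ i, minVar t.1.1.2 < i ∧ t.2 = Finsupp.single i 1 := by
  constructor
  · intro h
    obtain ⟨q, hq, rfl⟩ := Finset.mem_map.1 h
    exact ⟨q.2, (Finset.mem_filter.1 hq).2, rfl⟩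
  · rintro ⟨i, hi, ht⟩
    exact Finset.mem_map.2 ⟨(t.1, i), Finset.mem_filter.2 ⟨Finset.mem_univ _, hi⟩,
      Prod.ext rfl ht.symm⟩

theorem term_mem_next {ι : Type} {P : Finset (Term n ι)} (t : Term n P) :
    term K t ∈ Submodule.span (Poly n K) (term K '' (nextBasis P : Set (Term n P))) ↔
      ∃ i, minVar t.1.1.2 < i ∧ t.2 i ≠ 0 := by
  classical
  constructor
  · intro h
    have hle : Submodule.span (Poly n K) (term K '' (nextBasis P : Set (Term n P))) ≤
        Submodule.pi Set.univ fun a : P =>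
          Ideal.span (MvPolynomial.X '' {i | minVar a.1.2 < i} : Set (Poly n K)) := by
      rw [Submodule.span_le]
      rintro _ ⟨s, hs, rfl⟩
      obtain ⟨i, hi, hs2⟩ := mem_nextBasis.1 (Finset.mem_coe.1 hs)
      intro a _
      by_cases ha : a = s.1
      · subst ha
        simp only [term, if_true, hs2]
        exact Ideal.subset_span ⟨i, hi, rfl⟩
      · simp [term, ha]
    have h1 := hle h t.1 (Set.mem_univ _)
    simp only [term, if_true] at h1
    obtain ⟨i, hi, h2⟩ := MvPolynomial.mem_ideal_span_X_image.1 h1 t.2 (by simp)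
    exact ⟨i, hi, h2⟩
  · rintro ⟨i, hi, h2⟩
    have hle : Finsupp.single i 1 ≤ t.2 := by
      rw [Finsupp.single_le_iff]; omega
    have : term K t = (MvPolynomial.monomial (t.2 - Finsupp.single i 1) (1 : K)) •
        term K ((t.1, Finsupp.single i 1) : Term n P) := by
      ext1 k
      by_cases hk : k = t.1
      · simp only [term, hk, Pi.smul_apply, if_true, smul_eq_mul, MvPolynomial.monomial_mul,
          mul_one, tsub_add_cancel_of_le hle]
      · simp [term, hk]
    have hmem : ((t.1, Finsupp.single i 1) : Term n P) ∈ nextBasis P :=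
      mem_nextBasis.2 ⟨i, hi, rfl⟩
    rw [this]
    exact Submodule.smul_mem _ _ (Submodule.subset_span ⟨_, Finset.mem_coe.2 hmem, rfl⟩)

theorem isPommaretBasis_next {ι : Type} (P : Finset (Term n ι)) :
    IsPommaretBasis (K := K)
      (Submodule.span (Poly n K) (term K '' (nextBasis P : Set (Term n P)))) (nextBasis P) := by
  refine ⟨rfl, ?_, ?_⟩
  · ext t
    simp only [Set.mem_ofPred_eq, term_mem_next, Set.mem_iUnion, exists_prop]
    constructor
    · rintro ⟨i, hi, h2⟩
      have hne : t.2.support.Nonempty := ⟨i, by simpa using h2⟩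
      set j := t.2.support.max' hne with hj
      have hj0 : t.2 j ≠ 0 := by simpa using t.2.support.max'_mem hne
      have hij : i ≤ j := t.2.support.le_max' i (by simpa using h2)
      refine ⟨(t.1, Finsupp.single j 1), mem_nextBasis.2 ⟨j, hi.trans_le hij, rfl⟩, rfl,
        t.2 - Finsupp.single j 1, fun k hk => ?_, ?_⟩
      · rw [minVar_single]
        refine t.2.support.le_max' k ?_
        rw [Finsupp.mem_support_iff]
        intro h0
        exact hk (by simp [h0])
      · refine (tsub_add_cancel_of_le ?_).symm
        rw [Finsupp.single_le_iff]; omega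
    · rintro ⟨p, hp, h1, δ, -, h2⟩
      obtain ⟨i, hi, hp2⟩ := mem_nextBasis.1 hp
      exact ⟨i, h1 ▸ hi, by rw [h2, hp2]; simp⟩
  · intro p hp q hq hpq
    obtain ⟨i, -, hp2⟩ := mem_nextBasis.1 (Finset.mem_coe.1 hp)
    obtain ⟨j, -, hq2⟩ := mem_nextBasis.1 (Finset.mem_coe.1 hq)
    refine Set.disjoint_left.2 ?_
    rintro t ⟨h1, δ, hδ, h2⟩ ⟨h1', δ', hδ', h2'⟩
    rw [hp2, minVar_single] at hδ
    rw [hq2, minVar_single] at hδ'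
    rw [hp2] at h2
    rw [hq2] at h2'
    apply hpq
    have e := h2.symm.trans h2'
    have key : ∀ {a b : Fin (n + 1)} {ε ε' : Fin (n + 1) →₀ ℕ},
        ε + Finsupp.single a 1 = ε' + Finsupp.single b 1 → (∀ k, ε' k ≠ 0 → k ≤ b) → a ≤ b := by
      intro a b ε ε' e h
      by_contra hab
      have e' := DFunLike.congr_fun e a
      rw [Finsupp.add_apply, Finsupp.add_apply, Finsupp.single_eq_same,
        Finsupp.single_eq_of_ne (by rintro rfl; exact hab le_rfl)] at e'
      exact hab (h a (by omega))
    have hij : i = j := le_antisymm (key e hδ') (key e.symm hδ)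
    exact Prod.ext (h1.symm.trans h1') (by rw [hp2, hq2, hij])

/-- The stable module `U'` in the free module with basis `(f_a)_{a ∈ P_U}`, `deg f_a = deg a`,
whose Pommaret basis consists of the terms `x_i f_a` with `x_i` non-multiplicative for `a`. -/
@[reducible] noncomputable def QSModule.next (X : QSModule K n) : QSModule K n where
  ι := X.P
  d := fun a => termDegree X.d a.1
  U := Submodule.span (Poly n K) (term K '' (nextBasis X.P : Set (Term n X.P)))
  P := nextBasis X.P
  isPommaretBasis := isPommaretBasis_next X.P

/-- The modules `U^(t)`: `U^(0) = U` and `U^(t+1) = (U^(t))'`. -/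
noncomputable def QSModule.iter (X : QSModule K n) : ℕ → QSModule K n
  | 0 => X
  | t + 1 => (X.iter t).next

/-- The length `n - D` of the `U`-resolution, where `D` is the smallest index of a variable
`min(x^α)` with `x^α e_k ∈ P_U`. -/
noncomputable def QSModule.length (X : QSModule K n) : ℕ := n - (X.P.inf fun a => minVar a.2 : Fin (n + 1)).1

end Next

/-! ### Marked sets, marked bases, fundamental syzygies -/

section Marked

variable {K : Type u} [Field K] {n : ℕ} (X : QSModule K n) {A : Type u} [CommRing A]

/-- The `A`-module `⟨N(U)⟩` generated by the terms that are not in `U`. -/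
noncomputable def QSModule.normalForms (A : Type u) [CommRing A] : Submodule A (X.ι → Poly n A) :=
  Submodule.span A (term A '' {t | term K t ∉ X.U})

/-- The condition `M ⊕ ⟨N(U)⟩ = R_A^m(-d)` on a graded submodule `M`. -/
def QSModule.IsMarkedModule (M : Submodule (Poly n A) (X.ι → Poly n A)) : Prop :=
  IsGraded X.d M ∧ IsCompl (M.restrictScalars A) (X.normalForms A)

/-- `F = (F_a)_{a ∈ P_U}` is a `U`-marked set: `F_a` is homogeneous (of degree `deg a`), the head
term `a` has coefficient `1` in `F_a`, all other terms of `F_a` are in `N(U)`. -/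
def QSModule.IsMarkedSet (F : X.P → X.ι → Poly n A) : Prop :=
  ∀ a : X.P, IsHomog X.d (termDegree X.d a.1) (F a) ∧
    MvPolynomial.coeff a.1.2 (F a a.1.1) = 1 ∧
    ∀ t : Term n X.ι, t ≠ a.1 → MvPolynomial.coeff t.2 (F a t.1) ≠ 0 → term K t ∉ X.U

/-- `F` is a `U`-marked basis (of the module `(F)`): a `U`-marked set with
`R_A^m(-d) = (F) ⊕ ⟨N(U)⟩`. As all modules involved are graded, this is the same as
requiring the decomposition in each degree. -/
def QSModule.IsMarkedBasis (F : X.P → X.ι → Poly n A) : Prop :=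
  X.IsMarkedSet F ∧
    IsCompl ((Submodule.span (Poly n A) (Set.range F)).restrictScalars A) (X.normalForms A)

/-- The map `∂ : ⨁_a R_A f_a → R_A^m`, `f_a ↦ F_a`. -/
noncomputable def QSModule.boundary (F : X.P → X.ι → Poly n A) :
    (X.P → Poly n A) →ₗ[Poly n A] (X.ι → Poly n A) :=
  Fintype.linearCombination (Poly n A) F

/-- The module `Syz(F) = ker ∂` of first syzygies of `F`. -/
noncomputable def QSModule.syz (F : X.P → X.ι → Poly n A) :
    Submodule (Poly n A) (X.P → Poly n A) :=
  LinearMap.ker (X.boundary F)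

/-- All terms of the coefficients `Q_c`, `c ∈ P_U`, involve only multiplicative variables of `c`,
that is, `supp(Q_c x^γ) ⊆ C(x^γ)` for `c = x^γ e_ℓ`. -/
def QSModule.IsMultiplicative (Q : X.P → Poly n A) : Prop :=
  ∀ (c : X.P) (η : Fin (n + 1) →₀ ℕ), MvPolynomial.coeff η (Q c) ≠ 0 →
    ∀ j, η j ≠ 0 → j ≤ minVar c.1.2

/-- `G` is the family of fundamental syzygies of `F`: the member with index `x_i f_a`
(`x_i` a non-multiplicative variable of `a`) is `x_i f_a - ∑_c Q_c f_c`, where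
`x_i F_a = ∑_c Q_c F_c` is the writing with multiplicative coefficients `Q_c`. -/
def QSModule.IsFundamentalSyzygies (F : X.P → X.ι → Poly n A)
    (G : nextBasis X.P → X.P → Poly n A) : Prop :=
  ∀ q : nextBasis X.P, ∃ Q : X.P → Poly n A, X.IsMultiplicative Q ∧
    X.boundary F (term A q.1) = X.boundary F Q ∧ G q = term A q.1 - Q

/-- `S` is the syzygy module of the `U`-marked basis generating `M`. -/
def QSModule.IsSyzygyModule (M : Submodule (Poly n A) (X.ι → Poly n A))
    (S : Submodule (Poly n A) (X.P → Poly n A)) : Prop :=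
  ∃ F : X.P → X.ι → Poly n A, X.IsMarkedBasis F ∧
    Submodule.span (Poly n A) (Set.range F) = M ∧ S = X.syz F

/-- `S = (S_1, …, S_{n-D})` (with `S_{t+1}` written as `S t`) is the sequence of syzygy modules in
the `U`-resolution of `M`: there are `U^(t)`-marked bases `F t` such that `F 0` generates `M`,
`F (t+1)` is the set of fundamental syzygies of `F t`, and `S_{t+1}` is the syzygy module of
`F t`. (For `t > n - D` the family `F t` is empty.) -/
def QSModule.IsSyzygySequence (M : Submodule (Poly n A) (X.ι → Poly n A))
    (S : ∀ t : Fin X.length, Submodule (Poly n A) ((X.iter t).P → Poly n A)) : Prop :=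
  ∃ F : ∀ t : ℕ, (X.iter t).P → (X.iter t).ι → Poly n A,
    (∀ t, (X.iter t).IsMarkedBasis (F t)) ∧
    Submodule.span (Poly n A) (Set.range (F 0)) = M ∧
    (∀ t, (X.iter t).IsFundamentalSyzygies (F t) (F (t + 1))) ∧
    ∀ t : Fin X.length, S t = (X.iter t).syz (F t)

end Marked

/-! ### Extension of scalars -/

section BaseChange

variable {n : ℕ} {ι κ : Type*} {A B C : Type*} [CommRing A] [CommRing B] [CommRing C]

/-- The coefficientwise action of a ring homomorphism `σ : A → B` on `R_A^ι`. -/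
noncomputable def mapVec (σ : A →+* B) (f : ι → Poly n A) : ι → Poly n B :=
  fun k => MvPolynomial.map σ (f k)

/-- The extension of scalars `σ(M)`: the submodule of `R_B^ι` generated by the image of `M`. -/
noncomputable def extend (σ : A →+* B) (M : Submodule (Poly n A) (ι → Poly n A)) :
    Submodule (Poly n B) (ι → Poly n B) :=
  Submodule.span (Poly n B) (mapVec σ '' (M : Set (ι → Poly n A)))

theorem mapVec_add (σ : A →+* B) (f g : ι → Poly n A) :
    mapVec σ (f + g) = mapVec σ f + mapVec σ g := by
  ext1 k; simp [mapVec]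

theorem mapVec_sub (σ : A →+* B) (f g : ι → Poly n A) :
    mapVec σ (f - g) = mapVec σ f - mapVec σ g := by
  ext1 k; simp [mapVec]

theorem mapVec_zero (σ : A →+* B) : mapVec σ (0 : ι → Poly n A) = 0 := by
  ext1 k; simp [mapVec]

theorem mapVec_smul (σ : A →+* B) (r : Poly n A) (f : ι → Poly n A) :
    mapVec σ (r • f) = MvPolynomial.map σ r • mapVec σ f := by
  ext1 k; simp [mapVec]

theorem mapVec_smul' (σ : A →+* B) (r : A) (f : ι → Poly n A) :
    mapVec σ (r • f) = σ r • mapVec σ f := by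
  ext1 k; simp [mapVec, MvPolynomial.smul_eq_C_mul]

theorem mapVec_term (σ : A →+* B) (t : Term n ι) : mapVec σ (term A t) = term B t := by
  classical
  ext1 k
  by_cases h : k = t.1
  · simp [mapVec, term, h]
  · simp [mapVec, term, h]

theorem mapVec_id (f : ι → Poly n A) : mapVec (RingHom.id A) f = f := by
  ext1 k; exact MvPolynomial.map_id (f k)

theorem mapVec_comp (σ : A →+* B) (τ : B →+* C) (f : ι → Poly n A) :
    mapVec (τ.comp σ) f = mapVec τ (mapVec σ f) := by
  ext1 k; simp [mapVec, MvPolynomial.map_map]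

theorem extend_span (σ : A →+* B) (s : Set (ι → Poly n A)) :
    extend σ (Submodule.span (Poly n A) s) = Submodule.span (Poly n B) (mapVec σ '' s) := by
  refine le_antisymm (Submodule.span_le.2 ?_)
    (Submodule.span_mono (Set.image_mono Submodule.subset_span))
  rintro _ ⟨f, hf, rfl⟩
  induction hf using Submodule.span_induction with
  | mem x hx => exact Submodule.subset_span ⟨x, hx, rfl⟩
  | zero => rw [mapVec_zero]; exact Submodule.zero_mem _
  | add x y _ _ hx hy => rw [mapVec_add]; exact Submodule.add_mem _ hx hy
  | smul r x _ hx => rw [mapVec_smul]; exact Submodule.smul_mem _ _ hx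

theorem extend_id (M : Submodule (Poly n A) (ι → Poly n A)) : extend (RingHom.id A) M = M := by
  have : mapVec (n := n) (ι := ι) (RingHom.id A) = id := funext mapVec_id
  rw [extend, this, Set.image_id, Submodule.span_eq]

theorem extend_comp (σ : A →+* B) (τ : B →+* C) (M : Submodule (Poly n A) (ι → Poly n A)) :
    extend (τ.comp σ) M = extend τ (extend σ M) := by
  have : mapVec (n := n) (ι := ι) (τ.comp σ) = mapVec τ ∘ mapVec σ :=
    funext (mapVec_comp σ τ)
  rw [extend.eq_def σ M, extend_span, extend, this, Set.image_comp]

/-- As an `A`-module, `σ(M)` is generated by the image of `M`. -/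
theorem extend_restrictScalars (σ : A →+* B) (M : Submodule (Poly n A) (ι → Poly n A)) :
    (extend σ M).restrictScalars B =
      Submodule.span B (mapVec σ '' (M : Set (ι → Poly n A))) := by
  refine le_antisymm ?_ (Submodule.span_le.2 fun x hx => Submodule.subset_span hx)
  have hmon : ∀ (α : Fin (n + 1) →₀ ℕ) (x : ι → Poly n B),
      x ∈ Submodule.span B (mapVec σ '' (M : Set (ι → Poly n A))) →
      MvPolynomial.monomial α (1 : B) • x ∈
        Submodule.span B (mapVec σ '' (M : Set (ι → Poly n A))) := by
    intro α x hx
    induction hx using Submodule.span_induction with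
    | mem x hx =>
      obtain ⟨f, hf, rfl⟩ := hx
      refine Submodule.subset_span ⟨MvPolynomial.monomial α (1 : A) • f, M.smul_mem _ hf, ?_⟩
      rw [mapVec_smul, MvPolynomial.map_monomial, map_one]
    | zero => rw [smul_zero]; exact Submodule.zero_mem _
    | add x y _ _ hx hy => rw [smul_add]; exact Submodule.add_mem _ hx hy
    | smul c x _ hx => rw [smul_comm]; exact Submodule.smul_mem _ _ hx
  have key : ∀ x ∈ Submodule.span (Poly n B) (mapVec σ '' (M : Set (ι → Poly n A))),
      x ∈ Submodule.span B (mapVec σ '' (M : Set (ι → Poly n A))) := by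
    intro x hx
    induction hx using Submodule.span_induction with
    | mem x hx => exact Submodule.subset_span hx
    | zero => exact Submodule.zero_mem _
    | add x y _ _ hx hy => exact Submodule.add_mem _ hx hy
    | smul r x _ hx =>
      induction r using MvPolynomial.induction_on' with
      | add p q hp hq => rw [add_smul]; exact Submodule.add_mem _ hp hq
      | monomial α b =>
        have : MvPolynomial.monomial α b • x = b • (MvPolynomial.monomial α (1 : B) • x) := by
          rw [← smul_assoc, MvPolynomial.smul_monomial, smul_eq_mul, mul_one]
        rw [this]
        exact Submodule.smul_mem _ _ (hmon α x hx)
  exact fun x hx => key x hx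

theorem isGraded_extend {d : ι → ℤ} (σ : A →+* B) {M : Submodule (Poly n A) (ι → Poly n A)}
    (hM : IsGraded d M) : IsGraded d (extend σ M) := by
  refine le_antisymm (Submodule.span_le.2 fun f hf => hf.1) ?_
  conv_lhs => rw [← hM, extend_span]
  refine Submodule.span_mono ?_
  rintro _ ⟨f, ⟨hf, s, hs⟩, rfl⟩
  refine ⟨Submodule.subset_span ⟨f, hf, rfl⟩, s, fun t ht => hs t fun h => ht ?_⟩
  rw [mapVec, MvPolynomial.coeff_map, h, map_zero]

/-- The terms form an `A`-basis of `R_A^ι`. -/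
theorem exists_termBasis [Finite ι] (n : ℕ) (A : Type*) [CommRing A] :
    ∃ b : Module.Basis (Σ _ : ι, Fin (n + 1) →₀ ℕ) A (ι → Poly n A),
      ∀ t, b t = term A (t.1, t.2) := by
  classical
  have := Fintype.ofFinite ι
  refine ⟨Pi.basis fun _ => MvPolynomial.basisMonomials _ A, fun t => ?_⟩
  rw [Pi.basis_apply, MvPolynomial.coe_basisMonomials]
  ext1 k
  by_cases h : k = t.1
  · subst h; simp [term]
  · simp [term, h]

/-- An `A`-linear map between free modules extends to a `B`-linear one. -/
theorem exists_extension [Finite ι] (σ : A →+* B)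
    (L : (ι → Poly n A) →ₗ[A] (κ → Poly n A)) :
    ∃ L' : (ι → Poly n B) →ₗ[B] (κ → Poly n B), ∀ f, L' (mapVec σ f) = mapVec σ (L f) := by
  obtain ⟨b, hb⟩ := exists_termBasis (ι := ι) n A
  obtain ⟨b', hb'⟩ := exists_termBasis (ι := ι) n B
  refine ⟨b'.constr B fun t => mapVec σ (L (b t)), fun f => ?_⟩
  let φ : (ι → Poly n A) →ₛₗ[σ] (κ → Poly n B) :=
    { toFun := fun f => (b'.constr B fun t => mapVec σ (L (b t))) (mapVec σ f)
      map_add' := fun f g => by rw [mapVec_add, map_add]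
      map_smul' := fun r f => by rw [mapVec_smul', map_smul] }
  let ψ : (ι → Poly n A) →ₛₗ[σ] (κ → Poly n B) :=
    { toFun := fun f => mapVec σ (L f)
      map_add' := fun f g => by rw [map_add, mapVec_add]
      map_smul' := fun r f => by rw [map_smul, mapVec_smul'] }
  have h : φ = ψ := b.ext fun t => by
    change (b'.constr B fun t => mapVec σ (L (b t))) (mapVec σ (b t)) = mapVec σ (L (b t))
    rw [hb t, mapVec_term, ← hb' t, Module.Basis.constr_basis, hb t]
  exact DFunLike.congr_fun h f

theorem span_mapVec [Finite ι] (σ : A →+* B) :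
    Submodule.span B (Set.range (mapVec (n := n) (ι := ι) σ)) = ⊤ := by
  obtain ⟨b', hb'⟩ := exists_termBasis (ι := ι) n B
  rw [← top_le_iff, ← b'.span_eq, Submodule.span_le]
  rintro _ ⟨t, rfl⟩
  exact Submodule.subset_span ⟨term A (t.1, t.2), by rw [mapVec_term, hb' t]⟩

end BaseChange

section BaseChangeMarked

variable {K : Type u} [Field K] {n : ℕ} (X : QSModule K n)
  {A B : Type u} [CommRing A] [CommRing B] (σ : A →+* B)

theorem mapVec_normalForms {f : X.ι → Poly n A} (hf : f ∈ X.normalForms A) :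
    mapVec σ f ∈ X.normalForms B := by
  induction hf using Submodule.span_induction with
  | mem x hx =>
    obtain ⟨t, ht, rfl⟩ := hx
    exact Submodule.subset_span ⟨t, ht, (mapVec_term σ t).symm⟩
  | zero => rw [mapVec_zero]; exact Submodule.zero_mem _
  | add x y _ _ hx hy => rw [mapVec_add]; exact Submodule.add_mem _ hx hy
  | smul r x _ hx => rw [mapVec_smul']; exact Submodule.smul_mem _ _ hx

theorem isCompl_extend {M : Submodule (Poly n A) (X.ι → Poly n A)}
    (h : IsCompl (M.restrictScalars A) (X.normalForms A)) :
    IsCompl ((extend σ M).restrictScalars B) (X.normalForms B) := by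
  obtain ⟨p, hp⟩ := exists_extension σ ((X.normalForms A).projection _ h.symm)
  rw [extend_restrictScalars]
  constructor
  · rw [Submodule.disjoint_def]
    intro x hx hx'
    have h0 : p x = 0 := by
      have hle : Submodule.span B (mapVec σ '' (M : Set (X.ι → Poly n A))) ≤ LinearMap.ker p := by
        rw [Submodule.span_le]
        rintro _ ⟨f, hf, rfl⟩
        rw [SetLike.mem_coe, LinearMap.mem_ker, hp,
          (Submodule.projection_apply_eq_zero_iff h.symm).2 hf, mapVec_zero]
      exact hle hx
    have h1 : p x = x := by
      have hle : X.normalForms B ≤ LinearMap.eqLocus p LinearMap.id := by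
        refine Submodule.span_le.2 ?_
        rintro _ ⟨t, ht, rfl⟩
        have ht' : term A t ∈ X.normalForms A := Submodule.subset_span ⟨t, ht, rfl⟩
        rw [SetLike.mem_coe, LinearMap.mem_eqLocus, ← mapVec_term σ t, hp,
          Submodule.projection_apply_of_mem_left h.symm ht']
        rfl
      exact hle hx'
    exact h1.symm.trans h0
  · rw [codisjoint_iff, ← top_le_iff, ← span_mapVec σ, Submodule.span_le]
    rintro _ ⟨f, rfl⟩
    have hf : f ∈ M.restrictScalars A ⊔ X.normalForms A := by
      rw [h.sup_eq_top]; exact Submodule.mem_top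
    obtain ⟨g, hg, k, hk, rfl⟩ := Submodule.mem_sup.1 hf
    rw [mapVec_add]
    exact Submodule.add_mem_sup (Submodule.subset_span ⟨g, hg, rfl⟩) (mapVec_normalForms X σ hk)

theorem isMarkedModule_extend {M : Submodule (Poly n A) (X.ι → Poly n A)}
    (h : X.IsMarkedModule M) : X.IsMarkedModule (extend σ M) :=
  ⟨isGraded_extend σ h.1, isCompl_extend X σ h.2⟩

theorem extend_span_range (F : X.P → X.ι → Poly n A) :
    extend σ (Submodule.span (Poly n A) (Set.range F)) =
      Submodule.span (Poly n B) (Set.range fun a => mapVec σ (F a)) := by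
  rw [extend_span, ← Set.range_comp]; rfl

theorem isMarkedBasis_map {F : X.P → X.ι → Poly n A} (h : X.IsMarkedBasis F) :
    X.IsMarkedBasis fun a => mapVec σ (F a) := by
  refine ⟨fun a => ⟨fun t ht => (h.1 a).1 t fun h0 => ht ?_, ?_,
    fun t hta ht => (h.1 a).2.2 t hta fun h0 => ht ?_⟩, ?_⟩
  · simp only [mapVec, MvPolynomial.coeff_map, h0, map_zero]
  · simp only [mapVec, MvPolynomial.coeff_map, (h.1 a).2.1, map_one]
  · simp only [mapVec, MvPolynomial.coeff_map, h0, map_zero]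
  · rw [← extend_span_range]
    exact isCompl_extend X σ h.2

theorem boundary_map (F : X.P → X.ι → Poly n A) (g : X.P → Poly n A) :
    X.boundary (fun a => mapVec σ (F a)) (mapVec σ g) = mapVec σ (X.boundary F g) := by
  ext1 k
  simp [QSModule.boundary, Fintype.linearCombination_apply, mapVec, Finset.sum_apply]

theorem range_boundary (F : X.P → X.ι → Poly n A) :
    LinearMap.range (X.boundary F) = Submodule.span (Poly n A) (Set.range F) :=
  Fintype.range_linearCombination _ _

/-- Formation of the syzygy module of a marked basis commutes with extension of scalars. -/
theorem syz_map {F : X.P → X.ι → Poly n A} (h : X.IsMarkedBasis F) :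
    X.syz (fun a => mapVec σ (F a)) = extend σ (X.syz F) := by
  refine le_antisymm ?_ (Submodule.span_le.2 ?_)
  · obtain ⟨b, -⟩ := exists_termBasis (ι := X.ι) n A
    let p := (((Submodule.span (Poly n A) (Set.range F)).restrictScalars A).projection _ h.2)
    have hs : ∀ f, ∃ g, X.boundary F g = p f := fun f => by
      have : p f ∈ (Submodule.span (Poly n A) (Set.range F)).restrictScalars A :=
        Submodule.projection_apply_mem h.2 f
      have : p f ∈ LinearMap.range (X.boundary F) := by rw [range_boundary]; exact this
      exact this
    choose s₀ hs₀ using hs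
    let s : (X.ι → Poly n A) →ₗ[A] (X.P → Poly n A) := b.constr A fun t => s₀ (b t)
    have hs' : ((X.boundary F).restrictScalars A).comp s = p := b.ext fun t => by
      simp [s, Module.Basis.constr_basis, hs₀]
    have hsp : ∀ g, X.boundary F (s (X.boundary F g)) = X.boundary F g := fun g => by
      have h1 : X.boundary F (s (X.boundary F g)) = p (X.boundary F g) :=
        DFunLike.congr_fun hs' (X.boundary F g)
      rw [h1]
      refine Submodule.projection_apply_of_mem_left h.2 ?_
      have : X.boundary F g ∈ LinearMap.range (X.boundary F) := ⟨g, rfl⟩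
      rwa [range_boundary] at this
    obtain ⟨e, he⟩ := exists_extension σ
      (LinearMap.id - s.comp ((X.boundary F).restrictScalars A))
    obtain ⟨s', hs'⟩ := exists_extension σ s
    have heq : e = LinearMap.id -
        s'.comp ((X.boundary fun a => mapVec σ (F a)).restrictScalars B) := by
      refine LinearMap.ext_on_range (v := mapVec (n := n) (ι := X.P) σ) (span_mapVec σ) fun g => ?_
      rw [he]
      simp only [LinearMap.sub_apply, LinearMap.id_apply, LinearMap.comp_apply,
        LinearMap.restrictScalars_apply, boundary_map, hs', mapVec_sub]
    intro g hg
    have hg0 : X.boundary (fun a => mapVec σ (F a)) g = 0 := hg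
    have hge : e g = g := by
      rw [heq]
      simp [hg0]
    have hmem : ∀ x, e x ∈ (extend σ (X.syz F)).restrictScalars B := by
      intro x
      have hx : x ∈ Submodule.span B (Set.range (mapVec (n := n) (ι := X.P) σ)) := by
        rw [span_mapVec]; exact Submodule.mem_top
      have hle : Submodule.span B (Set.range (mapVec (n := n) (ι := X.P) σ)) ≤
          ((extend σ (X.syz F)).restrictScalars B).comap e := by
        rw [Submodule.span_le]
        rintro _ ⟨y, rfl⟩
        rw [SetLike.mem_coe, Submodule.mem_comap, he]
        refine Submodule.subset_span ⟨_, ?_, rfl⟩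
        change X.boundary F (y - s (X.boundary F y)) = 0
        rw [map_sub, hsp, sub_self]
      exact hle hx
    rw [← hge]
    exact hmem g
  · rintro _ ⟨g, hg, rfl⟩
    have hg0 : X.boundary F g = 0 := hg
    change X.boundary (fun a => mapVec σ (F a)) (mapVec σ g) = 0
    rw [boundary_map, hg0, mapVec_zero]

theorem isFundamentalSyzygies_map {F : X.P → X.ι → Poly n A} {G : nextBasis X.P → X.P → Poly n A}
    (h : X.IsFundamentalSyzygies F G) :
    X.IsFundamentalSyzygies (fun a => mapVec σ (F a)) fun q => mapVec σ (G q) := by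
  intro q
  obtain ⟨Q, hQ, h1, h2⟩ := h q
  refine ⟨mapVec σ Q, fun c η hη => hQ c η fun h0 => hη ?_, ?_, ?_⟩
  · rw [mapVec, MvPolynomial.coeff_map, h0, map_zero]
  · rw [boundary_map, ← h1, ← boundary_map, mapVec_term]
  · change mapVec σ (G q) = _
    rw [h2, mapVec_sub, mapVec_term]

theorem isSyzygyModule_extend {M : Submodule (Poly n A) (X.ι → Poly n A)}
    {S : Submodule (Poly n A) (X.P → Poly n A)} (h : X.IsSyzygyModule M S) :
    X.IsSyzygyModule (extend σ M) (extend σ S) := by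
  obtain ⟨F, hF, rfl, rfl⟩ := h
  exact ⟨_, isMarkedBasis_map X σ hF, (extend_span_range X σ F).symm, (syz_map X σ hF).symm⟩

theorem isSyzygySequence_extend {M : Submodule (Poly n A) (X.ι → Poly n A)}
    {S : ∀ t : Fin X.length, Submodule (Poly n A) ((X.iter t).P → Poly n A)}
    (h : X.IsSyzygySequence M S) :
    X.IsSyzygySequence (extend σ M) fun t => extend σ (S t) := by
  obtain ⟨F, hF, rfl, hG, hS⟩ := h
  refine ⟨fun t a => mapVec σ (F t a), fun t => isMarkedBasis_map _ σ (hF t),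
    (extend_span_range X σ (F 0)).symm, fun t => isFundamentalSyzygies_map _ σ (hG t),
    fun t => ?_⟩
  simp only [hS t]
  exact (syz_map _ σ (hF t)).symm

end BaseChangeMarked

/-! ### The functors -/

section Functors

/-- The category of Noetherian `K`-algebras. -/
abbrev NoethAlg (K : Type u) [Field K] : Type (u + 1) :=
  ObjectProperty.FullSubcategory fun A : CommAlgCat.{u} K => IsNoetherianRing A

/-- The ring homomorphism underlying a morphism of Noetherian `K`-algebras. -/
def NoethAlg.ringHom {K : Type u} [Field K] {A B : NoethAlg K} (σ : A ⟶ B) : A.obj →+* B.obj :=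
  σ.hom.hom.toRingHom

theorem NoethAlg.ringHom_id {K : Type u} [Field K] (A : NoethAlg K) :
    NoethAlg.ringHom (𝟙 A) = RingHom.id A.obj := rfl

theorem NoethAlg.ringHom_comp {K : Type u} [Field K] {A B C : NoethAlg K} (σ : A ⟶ B)
    (τ : B ⟶ C) : NoethAlg.ringHom (σ ≫ τ) = (NoethAlg.ringHom τ).comp (NoethAlg.ringHom σ) :=
  rfl

variable {K : Type u} [Field K] {n : ℕ} (X : QSModule K n)

/-- The `U`-marked functor `A ↦ {M | M ⊕ ⟨N(U)⟩ = R_A^m(-d)}`. -/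
noncomputable def QSModule.markedFunctor : NoethAlg K ⥤ Type u where
  obj A := {M : Submodule (Poly n A.obj) (X.ι → Poly n A.obj) // X.IsMarkedModule M}
  map σ := ↾fun M => ⟨extend (NoethAlg.ringHom σ) M.1, isMarkedModule_extend X _ M.2⟩
  map_id _ := by
    refine ConcreteCategory.hom_ext _ _ fun M => Subtype.ext ?_
    exact extend_id M.1
  map_comp _ _ := by
    refine ConcreteCategory.hom_ext _ _ fun M => Subtype.ext ?_
    exact extend_comp _ _ M.1

/-- The `U`-marked syzygy functor: pairs `(M, S_1)`. -/
noncomputable def QSModule.syzygyFunctor : NoethAlg K ⥤ Type u where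
  obj A := {p : Submodule (Poly n A.obj) (X.ι → Poly n A.obj) ×
      Submodule (Poly n A.obj) (X.P → Poly n A.obj) //
    X.IsMarkedModule p.1 ∧ X.IsSyzygyModule p.1 p.2}
  map σ := ↾fun p => ⟨(extend (NoethAlg.ringHom σ) p.1.1, extend (NoethAlg.ringHom σ) p.1.2),
    isMarkedModule_extend X _ p.2.1, isSyzygyModule_extend X _ p.2.2⟩
  map_id _ := by
    refine ConcreteCategory.hom_ext _ _ fun p => Subtype.ext ?_
    exact Prod.ext (extend_id _) (extend_id _)
  map_comp _ _ := by
    refine ConcreteCategory.hom_ext _ _ fun p => Subtype.ext ?_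
    exact Prod.ext (extend_comp _ _ _) (extend_comp _ _ _)

/-- The `U`-marked resolution functor: tuples `(M, S_1, …, S_{n-D})`. -/
noncomputable def QSModule.resolutionFunctor : NoethAlg K ⥤ Type u where
  obj A := {p : Submodule (Poly n A.obj) (X.ι → Poly n A.obj) ×
      (∀ t : Fin X.length, Submodule (Poly n A.obj) ((X.iter t).P → Poly n A.obj)) //
    X.IsMarkedModule p.1 ∧ X.IsSyzygySequence p.1 p.2}
  map σ := ↾fun p => ⟨(extend (NoethAlg.ringHom σ) p.1.1,
      fun t => extend (NoethAlg.ringHom σ) (p.1.2 t)),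
    isMarkedModule_extend X _ p.2.1, isSyzygySequence_extend X _ p.2.2⟩
  map_id _ := by
    refine ConcreteCategory.hom_ext _ _ fun p => Subtype.ext ?_
    exact Prod.ext (extend_id _) (funext fun t => extend_id _)
  map_comp _ _ := by
    refine ConcreteCategory.hom_ext _ _ fun p => Subtype.ext ?_
    exact Prod.ext (extend_comp _ _ _) (funext fun t => extend_comp _ _ _)

/-- The projection `(M, S_1) ↦ M`. -/
noncomputable def QSModule.syzygyProj : X.syzygyFunctor ⟶ X.markedFunctor where
  app _ := ↾fun p => ⟨p.1.1, p.2.1⟩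
  naturality _ _ _ := rfl

/-- The projection `(M, S_1, …, S_{n-D}) ↦ M`. -/
noncomputable def QSModule.resolutionProj : X.resolutionFunctor ⟶ X.markedFunctor where
  app _ := ↾fun p => ⟨p.1.1, p.2.1⟩
  naturality _ _ _ := rfl

/-- The functor of points `A ↦ Hom_K(Spec A, Y)` of a `K`-scheme `Y` on Noetherian `K`-algebras. -/
noncomputable def pointsFunctor (Y : Over (Spec (.of K))) : NoethAlg K ⥤ Type u :=
  opOp _ ⋙ ((ObjectProperty.ι _).op ⋙ algSpec (.of K)).op ⋙ yoneda.obj Y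

/-- The `K`-scheme `Y` represents the functor `F` on Noetherian `K`-algebras. -/
def Represents (Y : Over (Spec (.of K))) (F : NoethAlg K ⥤ Type u) : Prop :=
  Nonempty (pointsFunctor Y ≅ F)

end Functors

/-! ### The marked scheme -/

section Scheme

variable {K : Type u} [Field K] {n : ℕ} (X : QSModule K n)

/-- The index set of the parameters `C_a^b`, with `a ∈ P_U`, `b ∈ N(U)` and `deg b = deg a`. -/
def QSModule.Param : Type :=
  {c : X.P × Term n X.ι // term K c.2 ∉ X.U ∧ termDegree X.d c.2 = termDegree X.d c.1.1}

instance QSModule.finite_param : Finite X.Param := by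
  have hfin : ∀ a : X.P, ∀ k : X.ι,
      Finite {β : Fin (n + 1) →₀ ℕ // β.degree ≤ (termDegree X.d a.1 - X.d k).toNat} :=
    fun a k => (Finsupp.finite_of_degree_le _).to_subtype
  let f : X.Param → Σ a : X.P, Σ k : X.ι,
      {β : Fin (n + 1) →₀ ℕ // β.degree ≤ (termDegree X.d a.1 - X.d k).toNat} :=
    fun c => ⟨c.1.1, c.1.2.1, c.1.2.2, by have := c.2.2; unfold termDegree at this ⊢; omega⟩
  refine Finite.of_injective f ?_
  rintro ⟨⟨a, k, β⟩, h⟩ ⟨⟨a', k', β'⟩, h'⟩ e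
  obtain ⟨rfl, e⟩ := Sigma.mk.inj_iff.1 e
  obtain ⟨rfl, e⟩ := Sigma.mk.inj_iff.1 (eq_of_heq e)
  obtain rfl := Subtype.mk.inj (eq_of_heq e)
  rfl

/-- The coefficient ring `K[C]`. -/
abbrev QSModule.ParamRing : Type u := MvPolynomial X.Param K

/-- The generic marked set `F_a = a - ∑_b C_a^b b`, with coefficients in `K[C]`. -/
noncomputable def QSModule.genericSet (a : X.P) : X.ι → Poly n X.ParamRing :=
  term X.ParamRing a.1 - ∑ᶠ c : {c : X.Param // c.1.1 = a},
    (MvPolynomial.X c.1 : X.ParamRing) • term X.ParamRing c.1.1.2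

/-- The ideal of `K[C]` generated by the coefficients of the normal forms `g` of all `x_i F_a`,
with `x_i` a non-multiplicative variable of `a`; the normal form is determined by the
unique writing `x_i F_a = ∑_c Q_c F_c + g` with multiplicative `Q_c` and `g ∈ ⟨N(U)⟩`. -/
noncomputable def QSModule.markedIdeal : Ideal X.ParamRing :=
  Ideal.span {q | ∃ (a : X.P) (i : Fin (n + 1)) (Q : X.P → Poly n X.ParamRing)
    (g : X.ι → Poly n X.ParamRing), minVar a.1.2 < i ∧ X.IsMultiplicative Q ∧
      g ∈ X.normalForms X.ParamRing ∧
      (MvPolynomial.X i : Poly n X.ParamRing) • X.genericSet a = X.boundary X.genericSet Q + g ∧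
      ∃ t : Term n X.ι, q = MvPolynomial.coeff t.2 (g t.1)}

/-- The marked scheme `Spec (K[C] / 𝒰)` over `K`. -/
noncomputable def QSModule.markedScheme : Over (Spec (.of K)) :=
  (algSpec (.of K)).obj (.op (.of K (X.ParamRing ⧸ X.markedIdeal)))

end Scheme

end MarkedSyz

namespace MarkedSyz

/-! ### Modules of vectors with prescribed support -/

section Supported

variable {n : ℕ} {ι : Type*} {A : Type*} [CommRing A]

/-! Everything rests on a reduction that terminates for every `U`-marked set `F`, basis or not. A
term of `U` is uniquely `x^δ a` with `a ∈ P` and `x^δ` multiplicative for `a`. Replacing it by `x^δ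
a - x^δ F_a` produces terms `x^δ b` with `b ∉ U`, and each of these is either outside `U` or of the
form `x^η c` with `η` colex-smaller than `δ` (`colex_lt`). Well-founded induction (`cone_mem`) and a
comparison of leading exponents (`coeff_boundary`) show that each vector is uniquely `∂ Q + g` with
`Q` multiplicative and `g ∈ ⟨N(U)⟩`.

Hence a marked set is a marked basis as soon as every non-multiplicative product `x_i F_a` reduces
to `g = 0` (`IsMarkedSet.isMarkedBasis`). A marked module has exactly one marked basis, and that
basis has exactly one family of fundamental syzygies. For the module `U'` spanned by the
non-multiplicative `x_i f_a`, "multiplicative" means precisely "normal form", so the fundamental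
syzygies form a `U'`-marked basis (`IsMarkedBasis.next`) and the construction iterates. All syzygy
data are thus functions of `M`, and both projections are bijective on every algebra.

Every marked set is a unique specialization of the generic one, and it is a marked basis exactly
when the specialization kills the marked ideal. So `K[C]/𝒰`, which is Noetherian because there are
finitely many parameters, corepresents the marked functor.

Points in Noetherian algebras determine a scheme only among locally Noetherian ones: affine charts
of such a scheme are again test objects, so lifts of the charts glue to an inverse
(`isIso_of_noetherian_points`). -/

theorem coeff_term [DecidableEq (Term n ι)] (s t : Term n ι) :
    MvPolynomial.coeff s.2 (term A t s.1) = if s = t then 1 else 0 := by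
  classical
  by_cases h : s.1 = t.1
  · simp only [term, h, if_true, MvPolynomial.coeff_monomial]
    refine if_congr ?_ rfl rfl
    exact ⟨fun h2 => Prod.ext h h2.symm, fun h2 => by rw [h2]⟩
  · simp only [term, h, if_false, MvPolynomial.coeff_zero]
    rw [if_neg fun e => h (by rw [e])]

theorem coeff_term_self (t : Term n ι) : MvPolynomial.coeff t.2 (term A t t.1) = 1 := by
  classical rw [coeff_term, if_pos rfl]

theorem coeff_term_ne {s t : Term n ι} (h : s ≠ t) :
    MvPolynomial.coeff s.2 (term A t s.1) = 0 := by
  classical rw [coeff_term, if_neg h]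

theorem monomial_smul_term (η : Fin (n + 1) →₀ ℕ) (t : Term n ι) :
    (MvPolynomial.monomial η (1 : A)) • term A t = term A (t.1, η + t.2) := by
  ext1 k
  by_cases h : k = t.1
  · simp [term, h, MvPolynomial.monomial_mul]
  · simp [term, h]

/-- The coefficient of a term, as a linear form. -/
noncomputable def termCoeff (A : Type*) [CommRing A] (t : Term n ι) :
    (ι → Poly n A) →ₗ[A] A :=
  MvPolynomial.lcoeff A t.2 ∘ₗ LinearMap.proj (R := A) (φ := fun _ : ι => Poly n A) t.1

theorem termCoeff_apply (t : Term n ι) (f : ι → Poly n A) :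
    termCoeff A t f = MvPolynomial.coeff t.2 (f t.1) := rfl

/-- Links the two descriptions used throughout: spans of terms, suited to linearity and induction,
and conditions on supports, in which the definitions are phrased. -/
theorem mem_span_term [Finite ι] {S : Set (Term n ι)} {f : ι → Poly n A} :
    f ∈ Submodule.span A (term A '' S) ↔
      ∀ t : Term n ι, MvPolynomial.coeff t.2 (f t.1) ≠ 0 → t ∈ S := by
  classical
  have := Fintype.ofFinite ι
  constructor
  · intro h t
    contrapose!
    intro ht
    have hle : Submodule.span A (term A '' S) ≤ LinearMap.ker (termCoeff A t) := by
      rw [Submodule.span_le]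
      rintro _ ⟨s, hs, rfl⟩
      exact coeff_term_ne fun e => ht (e ▸ hs)
    exact hle h
  · intro h
    have hf : f = ∑ k, ∑ α ∈ (f k).support,
        MvPolynomial.coeff α (f k) • term A ((k, α) : Term n ι) := by
      ext1 k
      simp only [Finset.sum_apply, Pi.smul_apply, term]
      rw [Finset.sum_eq_single k]
      · simp only [if_true, MvPolynomial.smul_monomial, smul_eq_mul, mul_one]
        exact (f k).as_sum
      · intro j _ hj
        exact Finset.sum_eq_zero fun α _ => by rw [if_neg hj.symm, smul_zero]
      · exact fun hk => absurd (Finset.mem_univ k) hk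
    rw [hf]
    refine Submodule.sum_mem _ fun k _ => Submodule.sum_mem _ fun α hα =>
      Submodule.smul_mem _ _ (Submodule.subset_span ⟨_, h (k, α) ?_, rfl⟩)
    exact MvPolynomial.mem_support_iff.1 hα

theorem isHomog_iff [Finite ι] {d : ι → ℤ} {s : ℤ} {f : ι → Poly n A} :
    IsHomog d s f ↔ f ∈ Submodule.span A (term A '' {t | termDegree d t = s}) :=
  mem_span_term.symm

theorem termDegree_add (d : ι → ℤ) (η : Fin (n + 1) →₀ ℕ) (t : Term n ι) :
    termDegree d (t.1, η + t.2) = η.degree + termDegree d t := by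
  simp only [termDegree, map_add, Nat.cast_add]; ring

end Supported

/-! ### The colexicographic order on exponents and Pommaret cones -/

section Order

variable {n : ℕ}

instance wellFoundedLT_colex : WellFoundedLT (Colex (Fin (n + 1) →₀ ℕ)) :=
  ⟨InvImage.wf (fun a : Colex (Fin (n + 1) →₀ ℕ) => toColex (⇑(ofColex a)))
    (wellFounded_lt (α := Colex (Fin (n + 1) → ℕ)))⟩

/-- Colex is decided at the largest index where the exponents differ. That index is at least `k`,
and at it the weak inequality is strict. -/
theorem toColex_lt_of {α β : Fin (n + 1) →₀ ℕ} (k : Fin (n + 1)) (hk : α k < β k)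
    (h : ∀ j, k < j → α j ≤ β j) : toColex α < toColex β := by
  classical
  let S := Finset.univ.filter fun j => α j ≠ β j
  have hS : S.Nonempty := ⟨k, by simp [S, hk.ne]⟩
  obtain ⟨h1, h2⟩ : S.max' hS ∈ S ∧ k ≤ S.max' hS :=
    ⟨S.max'_mem hS, S.le_max' k (by simp [S, hk.ne])⟩
  refine Finsupp.Colex.lt_iff.2 ⟨S.max' hS, fun j hj => ?_, ?_⟩
  · by_contra hne
    exact absurd (S.le_max' j (by simpa [S] using hne)) (not_le.2 hj)
  · rcases h2.eq_or_lt with h2 | h2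
    · rw [← h2]; exact hk
    · exact lt_of_le_of_ne (h _ h2) (by simpa [S] using h1)

theorem apply_eq_zero_of_lt_minVar {α : Fin (n + 1) →₀ ℕ} {j : Fin (n + 1)} (h : j < minVar α) :
    α j = 0 := by
  by_contra h0
  exact absurd (Finset.inf_le (f := id) (Finsupp.mem_support_iff.2 h0)) (not_le.2 h)

theorem minVar_le {α : Fin (n + 1) →₀ ℕ} {j : Fin (n + 1)} (h : α j ≠ 0) : minVar α ≤ j :=
  Finset.inf_le (f := id) (Finsupp.mem_support_iff.2 h)

end Order

/-! ### Pommaret cones and the comparisons that make reduction terminate. -/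

section Cones

variable {K : Type u} [Field K] {n : ℕ} (X : QSModule K n)

theorem QSModule.term_add_mem {t : Term n X.ι} (h : term K t ∈ X.U) (η : Fin (n + 1) →₀ ℕ) :
    term K ((t.1, η + t.2) : Term n X.ι) ∈ X.U := by
  rw [← monomial_smul_term]
  exact X.U.smul_mem _ h

theorem QSModule.exists_cone {t : Term n X.ι} (h : term K t ∈ X.U) :
    ∃ (a : X.P) (δ : Fin (n + 1) →₀ ℕ), (∀ j, δ j ≠ 0 → j ≤ minVar a.1.2) ∧
      t = (a.1.1, δ + a.1.2) := by
  have : t ∈ ⋃ p ∈ X.P, cone p := by rw [← X.isPommaretBasis.2.1]; exact h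
  simp only [Set.mem_iUnion] at this
  obtain ⟨a, ha, h1, δ, h2, h3⟩ := this
  exact ⟨⟨a, ha⟩, δ, h2, Prod.ext h1 h3⟩

theorem QSModule.basis_mem (a : X.P) : term K a.1 ∈ X.U := by
  rw [← X.isPommaretBasis.1]
  exact Submodule.subset_span ⟨a.1, a.2, rfl⟩

theorem QSModule.cone_inj {a c : X.P} {δ η : Fin (n + 1) →₀ ℕ}
    (hδ : ∀ j, δ j ≠ 0 → j ≤ minVar a.1.2) (hη : ∀ j, η j ≠ 0 → j ≤ minVar c.1.2)
    (h1 : a.1.1 = c.1.1) (h2 : δ + a.1.2 = η + c.1.2) : a = c ∧ δ = η := by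
  have hac : a = c := by
    by_contra hne
    have := X.isPommaretBasis.2.2 a.2 c.2 fun e => hne (Subtype.ext e)
    have h3 : ((a.1.1, δ + a.1.2) : Term n X.ι) ∈ cone a.1 := ⟨rfl, δ, hδ, rfl⟩
    exact Set.disjoint_left.1 this h3 ⟨h1, η, hη, h2⟩
  subst hac
  exact ⟨rfl, add_right_cancel h2⟩

/-- Since `δ` vanishes beyond `min(a)`, any variable of `ε` beyond it settles the comparison.
Otherwise `a` and `b` agree beyond `min(a)`, and `a` has no variable below it. Then `ε ≤ δ` at
`min(a)` would make `a` divide `b`, putting `b` in `U`. -/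
theorem QSModule.colex_lt {b : Term n X.ι} (hb : term K b ∉ X.U) (a : X.P)
    {δ ε : Fin (n + 1) →₀ ℕ} (hδ : ∀ j, δ j ≠ 0 → j ≤ minVar a.1.2)
    (h1 : b.1 = a.1.1) (h2 : ε + b.2 = δ + a.1.2) : toColex δ < toColex ε := by
  have h2' : ∀ j, ε j + b.2 j = δ j + a.1.2 j := fun j => DFunLike.congr_fun h2 j
  have hz : ∀ j, minVar a.1.2 < j → δ j = 0 := fun j hj => by
    by_contra h0; exact absurd (hδ j h0) (not_le.2 hj)
  by_cases hε : ∃ j, minVar a.1.2 < j ∧ ε j ≠ 0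
  · obtain ⟨j, hj, hj0⟩ := hε
    refine toColex_lt_of j (by rw [hz j hj]; omega) fun k hk => ?_
    rw [hz k (hj.trans hk)]; exact Nat.zero_le _
  · push Not at hε
    refine toColex_lt_of (minVar a.1.2) ?_ fun k hk => by rw [hz k hk]; exact Nat.zero_le _
    by_contra hle
    apply hb
    have hab : a.1.2 ≤ b.2 := fun j => by
      rcases lt_trichotomy j (minVar a.1.2) with hj | hj | hj
      · rw [apply_eq_zero_of_lt_minVar hj]; exact Nat.zero_le _
      · have := h2' j; rw [← hj] at hle; omega
      · have := h2' j; rw [hz j hj, hε j hj] at this; omega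
    have := X.term_add_mem (X.basis_mem a) (b.2 - a.1.2)
    rwa [tsub_add_cancel_of_le hab, ← h1] at this

/-- If `x_i` divided `x^η`, cancelling it would place `a` in the cone of `c`. Disjointness of cones
gives `a = c`, yet `x_i` is not multiplicative for `a`. So `x_i` divides `c`, and `x^η` involves
only variables below `x_i`. -/
theorem QSModule.colex_lt_single (a c : X.P) {i : Fin (n + 1)} (hi : minVar a.1.2 < i)
    {η : Fin (n + 1) →₀ ℕ} (hη : ∀ j, η j ≠ 0 → j ≤ minVar c.1.2)
    (h1 : a.1.1 = c.1.1) (h2 : Finsupp.single i 1 + a.1.2 = η + c.1.2) :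
    toColex η < toColex (Finsupp.single i 1) := by
  have h2' : ∀ j, Finsupp.single i 1 j + a.1.2 j = η j + c.1.2 j :=
    fun j => DFunLike.congr_fun h2 j
  have hηi : η i = 0 := by
    by_contra h0
    have hle : Finsupp.single i 1 ≤ η := by rw [Finsupp.single_le_iff]; omega
    have h3 : (0 : Fin (n + 1) →₀ ℕ) + a.1.2 = (η - Finsupp.single i 1) + c.1.2 := by
      rw [zero_add]
      apply add_left_cancel (a := Finsupp.single i 1)
      rw [h2, ← add_assoc, add_tsub_cancel_of_le hle]
    have hac := (X.cone_inj (a := a) (c := c) (by simp) (fun j hj => hη j fun h => hj (by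
      simp [h])) h1 h3).1
    rw [← hac] at hη
    exact absurd (hη i h0) (not_le.2 hi)
  have hci : minVar c.1.2 ≤ i := by
    apply minVar_le
    have := h2' i
    rw [Finsupp.single_eq_same, hηi] at this; omega
  refine toColex_lt_of i (by rw [hηi, Finsupp.single_eq_same]; exact one_pos) fun j hj => ?_
  have : η j = 0 := by
    by_contra h0
    exact absurd (hη j h0) (not_le.2 (hci.trans_lt hj))
  rw [this]; exact Nat.zero_le _

end Cones

/-! ### Reduction modulo a marked set -/

section Reduction

variable {K : Type u} [Field K] {n : ℕ} {X : QSModule K n} {A : Type u} [CommRing A]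

/-- The terms `x^η f_a` with `x^η` a product of multiplicative variables of `a`. -/
def QSModule.multTerms (X : QSModule K n) : Set (Term n X.P) :=
  {q | ∀ j, q.2 j ≠ 0 → j ≤ minVar q.1.1.2}

theorem QSModule.isMultiplicative_iff {Q : X.P → Poly n A} :
    X.IsMultiplicative Q ↔ Q ∈ Submodule.span A (term A '' X.multTerms) :=
  ⟨fun h => mem_span_term.2 fun t ht => h t.1 t.2 ht,
    fun h c η hη => mem_span_term.1 h (c, η) hη⟩

theorem QSModule.mem_normalForms {g : X.ι → Poly n A} :
    g ∈ X.normalForms A ↔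
      ∀ t : Term n X.ι, MvPolynomial.coeff t.2 (g t.1) ≠ 0 → term K t ∉ X.U :=
  mem_span_term

theorem QSModule.boundary_term (F : X.P → X.ι → Poly n A) (q : Term n X.P) :
    X.boundary F (term A q) = MvPolynomial.monomial q.2 (1 : A) • F q.1 := by
  classical
  rw [QSModule.boundary, Fintype.linearCombination_apply, Finset.sum_eq_single q.1]
  · simp [term]
  · intro b _ hb; simp [term, hb]
  · exact fun h => absurd (Finset.mem_univ _) h

/-- The elements `∂ Q + g`, homogeneous of degree `s`, with `Q` multiplicative with exponents
in `W` and `g ∈ ⟨N(U)⟩`. -/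
noncomputable def QSModule.redSpan (F : X.P → X.ι → Poly n A) (s : ℤ)
    (W : Set (Fin (n + 1) →₀ ℕ)) : Submodule A (X.ι → Poly n A) :=
  (Submodule.span A (term A '' {q | q ∈ X.multTerms ∧
      termDegree (fun a : X.P => termDegree X.d a.1) q = s ∧ q.2 ∈ W})).map
      ((X.boundary F).restrictScalars A) ⊔
    Submodule.span A (term A '' {t | term K t ∉ X.U ∧ termDegree X.d t = s})

theorem QSModule.redSpan_mono (F : X.P → X.ι → Poly n A) (s : ℤ)
    {W W' : Set (Fin (n + 1) →₀ ℕ)} (h : W ⊆ W') : X.redSpan F s W ≤ X.redSpan F s W' :=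
  sup_le_sup_right (Submodule.map_mono (Submodule.span_mono (Set.image_mono
    fun q (hq : q ∈ X.multTerms ∧ termDegree (fun a : X.P => termDegree X.d a.1) q = s ∧ q.2 ∈ W) =>
      (⟨hq.1, hq.2.1, h hq.2.2⟩ : _ ∧ _)))) _

theorem smul_mem_of_mem_span {ι : Type*} {S : Set (Term n ι)} {f : ι → Poly n A}
    (hf : f ∈ Submodule.span A (term A '' S)) (ε : Fin (n + 1) →₀ ℕ)
    {V : Submodule A (ι → Poly n A)}
    (h : ∀ t ∈ S, term A ((t.1, ε + t.2) : Term n ι) ∈ V) :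
    MvPolynomial.monomial ε (1 : A) • f ∈ V := by
  induction hf using Submodule.span_induction with
  | mem x hx =>
    obtain ⟨t, ht, rfl⟩ := hx
    rw [monomial_smul_term]
    exact h t ht
  | zero => rw [smul_zero]; exact V.zero_mem
  | add x y _ _ hx hy => rw [smul_add]; exact V.add_mem hx hy
  | smul r x _ hx => rw [smul_comm]; exact V.smul_mem _ hx

variable {F : X.P → X.ι → Poly n A}

theorem QSModule.IsMarkedSet.tail_mem (hF : X.IsMarkedSet F) (a : X.P) :
    F a - term A a.1 ∈ Submodule.span A (term A ''
      {t | term K t ∉ X.U ∧ termDegree X.d t = termDegree X.d a.1}) := by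
  refine mem_span_term.2 fun t ht => ?_
  rw [Pi.sub_apply, MvPolynomial.coeff_sub] at ht
  by_cases h : t = a.1
  · subst h
    rw [(hF a).2.1, coeff_term_self, sub_self] at ht
    exact absurd rfl ht
  · rw [coeff_term_ne h, sub_zero] at ht
    exact ⟨(hF a).2.2 t h ht, (hF a).1 t ht⟩

theorem QSModule.smul_mem_redSpan (F : X.P → X.ι → Poly n A) (a : X.P) (δ : Fin (n + 1) →₀ ℕ)
    (hδ : ∀ j, δ j ≠ 0 → j ≤ minVar a.1.2) {s : ℤ} (hs : δ.degree + termDegree X.d a.1 = s)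
    {W : Set (Fin (n + 1) →₀ ℕ)} (hW : δ ∈ W) :
    MvPolynomial.monomial δ (1 : A) • F a ∈ X.redSpan F s W := by
  refine Submodule.mem_sup_left ⟨term A (a, δ),
    Submodule.subset_span ⟨(a, δ), ⟨hδ, hs, hW⟩, rfl⟩, ?_⟩
  exact X.boundary_term F (a, δ)

theorem QSModule.term_mem_redSpan (F : X.P → X.ι → Poly n A) {t : Term n X.ι}
    (ht : term K t ∉ X.U) {s : ℤ} (hs : termDegree X.d t = s) (W : Set (Fin (n + 1) →₀ ℕ)) :
    term A t ∈ X.redSpan F s W :=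
  Submodule.mem_sup_right (Submodule.subset_span ⟨t, ⟨ht, hs⟩, rfl⟩)

/-- Colex induction on `δ`, simultaneously for all `a`. The bound on the exponents used is kept
because the criterion for marked bases needs it. -/
theorem QSModule.IsMarkedSet.cone_mem (hF : X.IsMarkedSet F) (δ : Fin (n + 1) →₀ ℕ) :
    ∀ a : X.P, (∀ j, δ j ≠ 0 → j ≤ minVar a.1.2) →
      term A ((a.1.1, δ + a.1.2) : Term n X.ι) ∈
        X.redSpan F (δ.degree + termDegree X.d a.1) {η | toColex η ≤ toColex δ} := by
  induction hε : toColex δ using WellFoundedLT.induction generalizing δ with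
  | _ ε ih =>
    subst hε
    intro a hδ
    have e : term A ((a.1.1, δ + a.1.2) : Term n X.ι) = MvPolynomial.monomial δ (1 : A) • F a -
        MvPolynomial.monomial δ (1 : A) • (F a - term A a.1) := by
      rw [smul_sub, sub_sub_cancel, monomial_smul_term]
    rw [e]
    refine Submodule.sub_mem _ (X.smul_mem_redSpan F a δ hδ rfl (le_refl (toColex δ)))
      (smul_mem_of_mem_span (hF.tail_mem a) δ ?_)
    rintro b ⟨hb, hb2⟩
    have hdeg : termDegree X.d (b.1, δ + b.2) = δ.degree + termDegree X.d a.1 := by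
      rw [termDegree_add, hb2]
    by_cases ht : term K ((b.1, δ + b.2) : Term n X.ι) ∈ X.U
    · obtain ⟨c, η, hη, e⟩ := X.exists_cone ht
      have hlt := X.colex_lt hb c hη (Prod.ext_iff.1 e).1 (Prod.ext_iff.1 e).2
      have := ih _ hlt η rfl c hη
      rw [e, ← hdeg, e, termDegree_add]
      exact X.redSpan_mono F _ (fun ξ (hξ : toColex ξ ≤ toColex η) => hξ.trans hlt.le) this
    · exact X.term_mem_redSpan F ht hdeg _

/-- For a multiple of a normal term the bound becomes strict, by `colex_lt`. -/
theorem QSModule.IsMarkedSet.add_mem (hF : X.IsMarkedSet F) {b : Term n X.ι}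
    (hb : term K b ∉ X.U) (ε : Fin (n + 1) →₀ ℕ) :
    term A ((b.1, ε + b.2) : Term n X.ι) ∈
        X.redSpan F (ε.degree + termDegree X.d b) {η | toColex η < toColex ε} := by
  rw [← termDegree_add]
  by_cases ht : term K ((b.1, ε + b.2) : Term n X.ι) ∈ X.U
  · obtain ⟨c, η, hη, e⟩ := X.exists_cone ht
    have hlt := X.colex_lt hb c hη (Prod.ext_iff.1 e).1 (Prod.ext_iff.1 e).2
    have := hF.cone_mem η c hη
    rw [e, termDegree_add]
    exact X.redSpan_mono F _ (fun ξ (hξ : toColex ξ ≤ toColex η) => hξ.trans_lt hlt) this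
  · exact X.term_mem_redSpan F ht rfl _

/-- The reduction of `x_i F_a` for a non-multiplicative variable `x_i` of `a`. -/
theorem QSModule.IsMarkedSet.X_smul_mem (hF : X.IsMarkedSet F) (a : X.P) {i : Fin (n + 1)}
    (hi : minVar a.1.2 < i) :
    (MvPolynomial.X i : Poly n A) • F a ∈ X.redSpan F (1 + termDegree X.d a.1)
      {η | toColex η < toColex (Finsupp.single i 1)} := by
  have hdeg : ((Finsupp.single i 1 : Fin (n + 1) →₀ ℕ).degree : ℤ) = 1 := by simp
  have e : (MvPolynomial.X i : Poly n A) • F a =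
      MvPolynomial.monomial (Finsupp.single i 1) (1 : A) • term A a.1 +
        MvPolynomial.monomial (Finsupp.single i 1) (1 : A) • (F a - term A a.1) := by
    rw [← smul_add, add_sub_cancel]; rfl
  rw [e]
  -- The head `x_i a` is controlled by `colex_lt_single`, the tail by `add_mem`.
  refine Submodule.add_mem _ ?_ (smul_mem_of_mem_span (hF.tail_mem a) _ ?_)
  · obtain ⟨c, η, hη, e⟩ := X.exists_cone (X.term_add_mem (X.basis_mem a) (Finsupp.single i 1))
    have hlt := X.colex_lt_single a c hi hη (Prod.ext_iff.1 e).1 (Prod.ext_iff.1 e).2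
    have := hF.cone_mem η c hη
    rw [monomial_smul_term, ← hdeg, ← termDegree_add, e, termDegree_add]
    exact X.redSpan_mono F _ (fun ξ (hξ : toColex ξ ≤ toColex η) => hξ.trans_lt hlt) this
  · rintro b ⟨hb, hb2⟩
    have := hF.add_mem hb (Finsupp.single i 1)
    rwa [hdeg, hb2] at this

theorem QSModule.IsMarkedSet.term_mem (hF : X.IsMarkedSet F) (t : Term n X.ι) :
    term A t ∈ X.redSpan F (termDegree X.d t) Set.univ := by
  by_cases ht : term K t ∈ X.U
  · obtain ⟨a, δ, hδ, rfl⟩ := X.exists_cone ht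
    rw [termDegree_add]
    exact X.redSpan_mono F _ (Set.subset_univ _) (hF.cone_mem δ a hδ)
  · exact X.term_mem_redSpan F ht rfl _

theorem QSModule.mem_redSpan {s : ℤ} {W : Set (Fin (n + 1) →₀ ℕ)} {f : X.ι → Poly n A} :
    f ∈ X.redSpan F s W ↔ ∃ (Q : X.P → Poly n A) (g : X.ι → Poly n A), X.IsMultiplicative Q ∧
      IsHomog (fun a : X.P => termDegree X.d a.1) s Q ∧
      (∀ q : Term n X.P, MvPolynomial.coeff q.2 (Q q.1) ≠ 0 → q.2 ∈ W) ∧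
      g ∈ X.normalForms A ∧ IsHomog X.d s g ∧ f = X.boundary F Q + g := by
  rw [QSModule.redSpan, Submodule.mem_sup]
  constructor
  · rintro ⟨_, ⟨Q, hQ, rfl⟩, g, hg, rfl⟩
    have hQ := mem_span_term.1 hQ
    have hg := mem_span_term.1 hg
    exact ⟨Q, g, fun c η h => (hQ (c, η) h).1, fun t h => (hQ t h).2.1, fun t h => (hQ t h).2.2,
      mem_normalForms.2 fun t h => (hg t h).1, fun t h => (hg t h).2, rfl⟩
  · rintro ⟨Q, g, h1, h2, h3, h4, h5, rfl⟩
    exact ⟨_, ⟨Q, mem_span_term.2 fun q hq => ⟨h1 q.1 q.2 hq, h2 q hq, h3 q hq⟩, rfl⟩, g,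
      mem_span_term.2 fun t ht => ⟨mem_normalForms.1 h4 t ht, h5 t ht⟩, rfl⟩

/-- The elements of the form `∂ Q` with `Q` multiplicative. -/
noncomputable def QSModule.multSpan (F : X.P → X.ι → Poly n A) :
    Submodule A (X.ι → Poly n A) :=
  (Submodule.span A (term A '' X.multTerms)).map ((X.boundary F).restrictScalars A)

theorem QSModule.mem_multSpan {f : X.ι → Poly n A} :
    f ∈ X.multSpan F ↔ ∃ Q, X.IsMultiplicative Q ∧ X.boundary F Q = f := by
  simp only [multSpan, Submodule.mem_map, isMultiplicative_iff]; rfl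

theorem QSModule.redSpan_le (s : ℤ) (W : Set (Fin (n + 1) →₀ ℕ)) :
    X.redSpan F s W ≤ X.multSpan F ⊔ X.normalForms A :=
  sup_le_sup (Submodule.map_mono (Submodule.span_mono (Set.image_mono fun _ h => h.1)))
    (Submodule.span_mono (Set.image_mono fun _ h => h.1))

theorem span_term_univ {ι : Type*} [Finite ι] :
    Submodule.span A (term (n := n) A '' (Set.univ : Set (Term n ι))) = ⊤ :=
  eq_top_iff.2 fun _ _ => mem_span_term.2 fun _ _ => Set.mem_univ _

theorem QSModule.IsMarkedSet.sup_eq_top (hF : X.IsMarkedSet F) :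
    X.multSpan F ⊔ X.normalForms A = ⊤ := by
  rw [eq_top_iff, ← span_term_univ, Submodule.span_le]
  rintro _ ⟨t, -, rfl⟩
  exact X.redSpan_le _ _ (hF.term_mem t)

theorem QSModule.IsMarkedSet.exists_writing (hF : X.IsMarkedSet F) (f : X.ι → Poly n A) :
    ∃ (Q : X.P → Poly n A) (g : X.ι → Poly n A), X.IsMultiplicative Q ∧
      g ∈ X.normalForms A ∧ f = X.boundary F Q + g := by
  have hf : f ∈ X.multSpan F ⊔ X.normalForms A := by
    rw [hF.sup_eq_top]; exact Submodule.mem_top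
  obtain ⟨x, hx, g, hg, rfl⟩ := Submodule.mem_sup.1 hf
  obtain ⟨Q, hQ, rfl⟩ := mem_multSpan.1 hx
  exact ⟨Q, g, hQ, hg, rfl⟩

/-- At a colex-maximal exponent nothing cancels. Suppose `x^ξ F_c`, with `(c, ξ) ≠ (a, δ)`,
contained `x^δ a`. It cannot come from the head `c`, since cones are disjoint, and coming from the
tail it would force `δ < ξ` by `colex_lt`. -/
theorem QSModule.IsMarkedSet.coeff_boundary (hF : X.IsMarkedSet F) (a : X.P)
    (δ : Fin (n + 1) →₀ ℕ) (hδ : ∀ j, δ j ≠ 0 → j ≤ minVar a.1.2) {Q : X.P → Poly n A}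
    (hQ : X.IsMultiplicative Q)
    (hmax : ∀ c η, MvPolynomial.coeff η (Q c) ≠ 0 → toColex η ≤ toColex δ) :
    MvPolynomial.coeff (δ + a.1.2) (X.boundary F Q a.1.1) = MvPolynomial.coeff δ (Q a) := by
  classical
  have hQ' : Q ∈ Submodule.span A (term A ''
      {q | q ∈ X.multTerms ∧ toColex q.2 ≤ toColex δ}) :=
    mem_span_term.2 fun q hq => ⟨hQ q.1 q.2 hq, hmax _ _ hq⟩
  have key : Submodule.span A (term A '' {q | q ∈ X.multTerms ∧ toColex q.2 ≤ toColex δ}) ≤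
      LinearMap.eqLocus (termCoeff A ((a.1.1, δ + a.1.2) : Term n X.ι) ∘ₗ
        (X.boundary F).restrictScalars A) (termCoeff A ((a, δ) : Term n X.P)) := by
    rw [Submodule.span_le]
    rintro _ ⟨q, ⟨hq, hle⟩, rfl⟩
    change MvPolynomial.coeff (δ + a.1.2) (X.boundary F (term A q) a.1.1) =
      MvPolynomial.coeff ((a, δ) : Term n X.P).2 (term A q ((a, δ) : Term n X.P).1)
    rw [X.boundary_term, coeff_term, Pi.smul_apply, smul_eq_mul, MvPolynomial.coeff_monomial_mul']
    by_cases hqa : (a, δ) = q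
    · subst hqa
      simp [(hF a).2.1]
    · rw [if_neg hqa]
      split_ifs with h
      · rw [one_mul]
        by_contra h0
        have hη : q.2 + (δ + a.1.2 - q.2) = δ + a.1.2 := add_tsub_cancel_of_le h
        by_cases hb : ((a.1.1, δ + a.1.2 - q.2) : Term n X.ι) = q.1.1
        · have h1 : a.1.1 = q.1.1.1 := (Prod.ext_iff.1 hb).1
          have h2 : δ + a.1.2 - q.2 = q.1.1.2 := (Prod.ext_iff.1 hb).2
          rw [h2] at hη
          obtain ⟨h3, h4⟩ := X.cone_inj hδ hq h1 hη.symm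
          exact hqa (Prod.ext h3 h4)
        · have hN := (hF q.1).2.2 _ hb h0
          exact absurd hle (not_le.2 (X.colex_lt hN a hδ rfl hη))
      · rfl
  exact key hQ'

/-- Uniqueness of the writing `∂ Q + g`. -/
theorem QSModule.IsMarkedSet.eq_zero (hF : X.IsMarkedSet F) {Q : X.P → Poly n A}
    {g : X.ι → Poly n A} (hQ : X.IsMultiplicative Q) (hg : g ∈ X.normalForms A)
    (h : X.boundary F Q + g = 0) : Q = 0 ∧ g = 0 := by
  classical
  have hQ0 : Q = 0 := by
    by_contra hne
    let S : Finset (Fin (n + 1) →₀ ℕ) := Finset.univ.biUnion fun c => (Q c).support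
    have hS : S.Nonempty := by
      obtain ⟨c, hc⟩ := Function.ne_iff.1 hne
      obtain ⟨η, hη⟩ := MvPolynomial.support_nonempty.2 hc
      exact ⟨η, Finset.mem_biUnion.2 ⟨c, Finset.mem_univ _, hη⟩⟩
    obtain ⟨δ, hδS, hmax⟩ := S.exists_max_image toColex hS
    obtain ⟨a, -, ha⟩ := Finset.mem_biUnion.1 hδS
    rw [MvPolynomial.mem_support_iff] at ha
    have hδ := hQ a δ ha
    have h1 := hF.coeff_boundary a δ hδ hQ fun c η hη => hmax η
      (Finset.mem_biUnion.2 ⟨c, Finset.mem_univ _, MvPolynomial.mem_support_iff.2 hη⟩)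
    -- The term `x^δ a` lies in `U`, so `g` cannot cancel the leading coefficient of `∂ Q`.
    have h2 : MvPolynomial.coeff (δ + a.1.2) (g a.1.1) = 0 := by
      by_contra h0
      exact mem_normalForms.1 hg (a.1.1, δ + a.1.2) h0 (X.term_add_mem (X.basis_mem a) δ)
    have h3 : MvPolynomial.coeff (δ + a.1.2) ((X.boundary F Q + g) a.1.1) = 0 := by
      rw [h]; simp
    rw [Pi.add_apply, MvPolynomial.coeff_add, h1, h2, add_zero] at h3
    exact ha h3
  subst hQ0
  exact ⟨rfl, by simpa using h⟩

theorem QSModule.IsMultiplicative.sub {Q Q' : X.P → Poly n A} (hQ : X.IsMultiplicative Q)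
    (hQ' : X.IsMultiplicative Q') : X.IsMultiplicative (Q - Q') :=
  isMultiplicative_iff.2 (Submodule.sub_mem _ (isMultiplicative_iff.1 hQ)
    (isMultiplicative_iff.1 hQ'))

theorem QSModule.IsMarkedSet.unique (hF : X.IsMarkedSet F) {Q Q' : X.P → Poly n A}
    {g g' : X.ι → Poly n A} (hQ : X.IsMultiplicative Q) (hg : g ∈ X.normalForms A)
    (hQ' : X.IsMultiplicative Q') (hg' : g' ∈ X.normalForms A)
    (h : X.boundary F Q + g = X.boundary F Q' + g') : Q = Q' ∧ g = g' := by
  have := hF.eq_zero (hQ.sub hQ') (Submodule.sub_mem _ hg hg') (by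
    rw [map_sub, ← sub_eq_zero.2 h]; abel)
  exact ⟨sub_eq_zero.1 this.1, sub_eq_zero.1 this.2⟩

theorem QSModule.IsMarkedSet.disjoint (hF : X.IsMarkedSet F) :
    Disjoint (X.multSpan F) (X.normalForms A) := by
  rw [Submodule.disjoint_def]
  intro f hf hN
  obtain ⟨Q, hQ, rfl⟩ := mem_multSpan.1 hf
  rw [(hF.eq_zero hQ (Submodule.neg_mem _ hN) (add_neg_cancel _)).1, map_zero]

end Reduction

/-! ### Marked bases -/

section MarkedBasis

variable {K : Type u} [Field K] {n : ℕ} {X : QSModule K n} {A : Type u} [CommRing A]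
  {F : X.P → X.ι → Poly n A}

theorem QSModule.multSpan_le (F : X.P → X.ι → Poly n A) :
    X.multSpan F ≤ (Submodule.span (Poly n A) (Set.range F)).restrictScalars A := by
  intro f hf
  obtain ⟨Q, -, rfl⟩ := mem_multSpan.1 hf
  rw [Submodule.restrictScalars_mem, ← range_boundary]
  exact ⟨Q, rfl⟩

theorem QSModule.mem_span_range (F : X.P → X.ι → Poly n A) (a : X.P) :
    F a ∈ Submodule.span (Poly n A) (Set.range F) :=
  Submodule.subset_span ⟨a, rfl⟩

theorem QSModule.boundary_mem (F : X.P → X.ι → Poly n A) (Q : X.P → Poly n A) :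
    X.boundary F Q ∈ Submodule.span (Poly n A) (Set.range F) := by
  rw [← range_boundary]; exact ⟨Q, rfl⟩

/-- A marked set is a marked basis as soon as the products of its members with non-multiplicative
variables can be written with multiplicative coefficients. -/
theorem QSModule.IsMarkedSet.isMarkedBasis (hF : X.IsMarkedSet F)
    (h : ∀ (a : X.P) (i : Fin (n + 1)), minVar a.1.2 < i →
      (MvPolynomial.X i : Poly n A) • F a ∈ X.multSpan F) : X.IsMarkedBasis F := by
  have hmon : ∀ (ε : Fin (n + 1) →₀ ℕ) (a : X.P),
      MvPolynomial.monomial ε (1 : A) • F a ∈ X.multSpan F := by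
    intro ε
    induction hε : toColex ε using WellFoundedLT.induction generalizing ε with
    | _ e ih =>
      subst hε
      intro a
      by_cases hm : ∀ j, ε j ≠ 0 → j ≤ minVar a.1.2
      · exact ⟨term A (a, ε), Submodule.subset_span ⟨(a, ε), hm, rfl⟩, X.boundary_term F (a, ε)⟩
      push Not at hm
      obtain ⟨i, hi0, hi⟩ := hm
      have hle : Finsupp.single i 1 ≤ ε := by rw [Finsupp.single_le_iff]; omega
      obtain ⟨Q, g, hQ, -, hlt, hg, -, e⟩ := mem_redSpan.1 (hF.X_smul_mem a hi)
      obtain ⟨Q', hQ', e'⟩ := mem_multSpan.1 (h a i hi)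
      -- The hypothesis supplies a multiplicative writing without exponent bound, the reduction a
      -- bounded one with a remainder. Uniqueness makes the remainder zero and keeps the bound.
      obtain ⟨-, rfl⟩ := hF.unique hQ hg hQ' (Submodule.zero_mem _)
        (by rw [← e, ← e', add_zero])
      rw [add_zero] at e
      have e2 : MvPolynomial.monomial ε (1 : A) • F a =
          MvPolynomial.monomial (ε - Finsupp.single i 1) (1 : A) • X.boundary F Q := by
        rw [← e, smul_smul, MvPolynomial.X, MvPolynomial.monomial_mul, mul_one,
          tsub_add_cancel_of_le hle]
      rw [e2, ← map_smul]
      have hQ2 : Q ∈ Submodule.span A (term A ''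
          -- Every exponent of `Q` is below that of `x_i`, so after multiplication by `x^ε / x_i` it
          -- is below `ε` and the induction hypothesis applies.
          {q | toColex q.2 < toColex (Finsupp.single i 1)}) := mem_span_term.2 hlt
      refine smul_mem_of_mem_span (V := (X.multSpan F).comap
        ((X.boundary F).restrictScalars A)) hQ2 _ fun q hq => ?_
      change X.boundary F (term A _) ∈ X.multSpan F
      rw [X.boundary_term]
      refine ih _ ?_ _ rfl _
      have := add_lt_add_right (a := toColex (ε - Finsupp.single i 1)) hq
      rwa [← toColex_add, ← toColex_add, tsub_add_cancel_of_le hle] at this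
  have hspan : (Submodule.span (Poly n A) (Set.range F)).restrictScalars A = X.multSpan F := by
    refine le_antisymm ?_ (X.multSpan_le F)
    intro f hf
    rw [Submodule.restrictScalars_mem, ← range_boundary] at hf
    obtain ⟨Q, rfl⟩ := hf
    have hle : Submodule.span A (term (n := n) A '' (Set.univ : Set (Term n X.P))) ≤
        (X.multSpan F).comap ((X.boundary F).restrictScalars A) := by
      rw [Submodule.span_le]
      rintro _ ⟨q, -, rfl⟩
      change X.boundary F (term A q) ∈ X.multSpan F
      rw [X.boundary_term]
      exact hmon _ _
    exact hle (by rw [span_term_univ]; exact Submodule.mem_top)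
  exact ⟨hF, by rw [hspan]; exact ⟨hF.disjoint, codisjoint_iff.2 hF.sup_eq_top⟩⟩

theorem QSModule.IsMarkedBasis.normalForm_eq_zero (hF : X.IsMarkedBasis F)
    {Q : X.P → Poly n A} {g : X.ι → Poly n A} (hg : g ∈ X.normalForms A)
    (h : X.boundary F Q + g ∈ Submodule.span (Poly n A) (Set.range F)) : g = 0 := by
  refine Submodule.disjoint_def.1 hF.2.disjoint g ?_ hg
  have := Submodule.sub_mem _ h (X.boundary_mem F Q)
  rwa [add_sub_cancel_left] at this

theorem QSModule.IsMarkedSet.sub_mem_normalForms {F' : X.P → X.ι → Poly n A} (hF : X.IsMarkedSet F)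
    (hF' : X.IsMarkedSet F') (a : X.P) : F a - F' a ∈ X.normalForms A := by
  have hle : Submodule.span A (term A ''
      {t | term K t ∉ X.U ∧ termDegree X.d t = termDegree X.d a.1}) ≤ X.normalForms A :=
    Submodule.span_mono (Set.image_mono fun _ h => h.1)
  have := Submodule.sub_mem _ (hle (hF.tail_mem a)) (hle (hF'.tail_mem a))
  rwa [sub_sub_sub_cancel_right] at this

/-- In `F_a - F'_a` the heads cancel, leaving an element of both the module and `⟨N(U)⟩`. -/
theorem QSModule.IsMarkedBasis.eq_of_span_eq {F' : X.P → X.ι → Poly n A}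
    (hF : X.IsMarkedBasis F) (hF' : X.IsMarkedBasis F')
    (h : Submodule.span (Poly n A) (Set.range F) = Submodule.span (Poly n A) (Set.range F')) :
    F = F' := by
  funext a
  rw [← sub_eq_zero]
  refine Submodule.disjoint_def.1 hF.2.disjoint _ ?_ (hF.1.sub_mem_normalForms hF'.1 a)
  exact Submodule.sub_mem _ (X.mem_span_range F a) (by rw [h]; exact X.mem_span_range F' a)

theorem QSModule.IsMarkedBasis.isMarkedModule (hF : X.IsMarkedBasis F) :
    X.IsMarkedModule (Submodule.span (Poly n A) (Set.range F)) := by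
  refine ⟨le_antisymm (Submodule.span_le.2 fun f hf => hf.1) (Submodule.span_le.2 ?_), hF.2⟩
  rintro _ ⟨a, rfl⟩
  exact Submodule.subset_span ⟨X.mem_span_range F a, _, (hF.1 a).1⟩

end MarkedBasis

/-! ### Homogeneous components -/

section Components

variable {n : ℕ} {ι : Type*} {A : Type*} [CommRing A]

/-- The homogeneous component of degree `s` of an element of `⨁ₖ R_A(-d_k) e_k`. -/
noncomputable def homogComponent (A : Type*) [CommRing A] (d : ι → ℤ) (s : ℤ) :
    (ι → Poly n A) →ₗ[A] (ι → Poly n A) :=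
  -- The guard matters: `toNat` sends negative integers to `0`, which would select constant terms in
  -- impossible degrees.
  LinearMap.pi fun k => if 0 ≤ s - d k then
    MvPolynomial.homogeneousComponent (s - d k).toNat ∘ₗ
      LinearMap.proj (R := A) (φ := fun _ : ι => Poly n A) k else 0

theorem coeff_homogComponent (d : ι → ℤ) (s : ℤ) (f : ι → Poly n A) (t : Term n ι) :
    MvPolynomial.coeff t.2 (homogComponent A d s f t.1) =
      if termDegree d t = s then MvPolynomial.coeff t.2 (f t.1) else 0 := by
  have hd : termDegree d t = t.2.degree + d t.1 := rfl
  simp only [homogComponent, LinearMap.pi_apply]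
  by_cases h : termDegree d t = s
  · rw [if_pos h, if_pos (by omega), LinearMap.comp_apply, LinearMap.proj_apply,
      MvPolynomial.coeff_homogeneousComponent, if_pos (by omega)]
  · rw [if_neg h]
    split_ifs with h1
    · rw [LinearMap.comp_apply, LinearMap.proj_apply, MvPolynomial.coeff_homogeneousComponent,
        if_neg (by omega)]
    · simp

theorem isHomog_homogComponent (d : ι → ℤ) (s : ℤ) (f : ι → Poly n A) :
    IsHomog d s (homogComponent A d s f) := by
  intro t ht
  rw [coeff_homogComponent] at ht
  by_contra h
  exact ht (if_neg h)

theorem vec_ext {f g : ι → Poly n A}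
    (h : ∀ t : Term n ι, MvPolynomial.coeff t.2 (f t.1) = MvPolynomial.coeff t.2 (g t.1)) :
    f = g := by
  funext k
  ext α
  exact h (k, α)

theorem IsHomog.homogComponent_eq {d : ι → ℤ} {s : ℤ} {f : ι → Poly n A} (hf : IsHomog d s f) :
    homogComponent A d s f = f := by
  refine vec_ext fun t => ?_
  rw [coeff_homogComponent]
  split_ifs with h
  · rfl
  · by_contra h0
    exact h (hf t (Ne.symm h0))

theorem IsHomog.homogComponent_eq_zero {d : ι → ℤ} {s s' : ℤ} {f : ι → Poly n A}
    (hf : IsHomog d s f) (hs : s ≠ s') : homogComponent A d s' f = 0 := by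
  refine vec_ext fun t => ?_
  rw [coeff_homogComponent]
  split_ifs with h
  · by_contra h0
    exact hs ((hf t h0).symm.trans h)
  · simp

/-- Over `A`, the module is spanned by monomial multiples of homogeneous elements. These are
homogeneous, so each projection fixes or kills them. -/
theorem IsGraded.homogComponent_mem [Finite ι] {d : ι → ℤ}
    {M : Submodule (Poly n A) (ι → Poly n A)} (hM : IsGraded d M) (s : ℤ) {f : ι → Poly n A}
    (hf : f ∈ M) : homogComponent A d s f ∈ M := by
  have h1 := Submodule.span_smul_of_span_eq_top
    (MvPolynomial.basisMonomials (Fin (n + 1)) A).span_eq {f | f ∈ M ∧ ∃ s, IsHomog d s f}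
  rw [hM] at h1
  have hle : M.restrictScalars A ≤ (M.restrictScalars A).comap (homogComponent A d s) := by
    rw [← h1, Submodule.span_le, h1]
    rintro _ ⟨_, ⟨η, rfl⟩, f, ⟨hf, s', hs'⟩, rfl⟩
    change homogComponent A d s ((MvPolynomial.basisMonomials (Fin (n + 1)) A η) • f) ∈ M
    rw [MvPolynomial.coe_basisMonomials]
    have hη : IsHomog d (η.degree + s') (MvPolynomial.monomial η (1 : A) • f) := by
      rw [isHomog_iff]
      refine smul_mem_of_mem_span (isHomog_iff.1 hs') η ?_
      rintro t rfl
      exact Submodule.subset_span ⟨_, termDegree_add d η t, rfl⟩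
    by_cases hs : η.degree + s' = s
    · subst hs
      rw [hη.homogComponent_eq]
      exact M.smul_mem _ hf
    · rw [hη.homogComponent_eq_zero hs]
      exact M.zero_mem
  exact hle hf

end Components

/-! ### Marked modules, their marked bases and their syzygies. -/

section MarkedModule

variable {K : Type u} [Field K] {n : ℕ} {X : QSModule K n} {A : Type u} [CommRing A]

theorem isHomog_term {ι : Type*} (d : ι → ℤ) (t : Term n ι) :
    IsHomog d (termDegree d t) (term A t) := by
  intro s hs
  by_contra h
  exact hs (coeff_term_ne fun e => h (by rw [e]))

/-- Every marked module is generated by a marked basis. -/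
theorem QSModule.IsMarkedModule.exists_basis {M : Submodule (Poly n A) (X.ι → Poly n A)}
    (hM : X.IsMarkedModule M) :
    ∃ F : X.P → X.ι → Poly n A, X.IsMarkedBasis F ∧
      Submodule.span (Poly n A) (Set.range F) = M := by
  have h : ∀ a : X.P, ∃ f ∈ M, ∃ g ∈ X.normalForms A, IsHomog X.d (termDegree X.d a.1) f ∧
      f + g = term A a.1 := by
    intro a
    have : term A a.1 ∈ M.restrictScalars A ⊔ X.normalForms A := by
      rw [hM.2.sup_eq_top]; exact Submodule.mem_top
    obtain ⟨f, hf, g, hg, e⟩ := Submodule.mem_sup.1 this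
    -- The splitting of `a` need not be assumed homogeneous; its component of degree `deg a` is
    -- again a splitting of `a`.
    refine ⟨homogComponent A X.d (termDegree X.d a.1) f, hM.1.homogComponent_mem _ hf,
      homogComponent A X.d (termDegree X.d a.1) g, mem_normalForms.2 fun t ht => ?_,
      isHomog_homogComponent _ _ _, ?_⟩
    · rw [coeff_homogComponent] at ht
      split_ifs at ht with h1
      · exact mem_normalForms.1 hg t ht
      · exact absurd rfl ht
    · rw [← map_add, e, (isHomog_term _ _).homogComponent_eq]
  choose F hFM G hG hhom hFG using h
  have hset : X.IsMarkedSet F := by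
    intro a
    have hc : ∀ t : Term n X.ι, MvPolynomial.coeff t.2 (F a t.1) =
        MvPolynomial.coeff t.2 (term A a.1 t.1) - MvPolynomial.coeff t.2 (G a t.1) := by
      intro t
      rw [← hFG a, Pi.add_apply, MvPolynomial.coeff_add, add_sub_cancel_right]
    refine ⟨hhom a, ?_, fun t hta ht => ?_⟩
    · have h0 : MvPolynomial.coeff a.1.2 (G a a.1.1) = 0 := by
        by_contra h0
        exact mem_normalForms.1 (hG a) a.1 h0 (X.basis_mem a)
      rw [hc, h0, coeff_term_self, sub_zero]
    · rw [hc, coeff_term_ne hta, zero_sub, neg_ne_zero] at ht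
      exact mem_normalForms.1 (hG a) t ht
  have hle : Submodule.span (Poly n A) (Set.range F) ≤ M := by
    rw [Submodule.span_le]
    rintro _ ⟨a, rfl⟩
    exact hFM a
  have heq : Submodule.span (Poly n A) (Set.range F) = M := by
    refine le_antisymm hle fun f hf => ?_
    obtain ⟨Q, g, hQ, hg, rfl⟩ := hset.exists_writing f
    have hgM : g ∈ M := by
      have := M.sub_mem hf (hle (X.boundary_mem F Q))
      rwa [add_sub_cancel_left] at this
    rw [Submodule.disjoint_def.1 hM.2.disjoint g hgM hg, add_zero]
    exact X.boundary_mem F Q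
  exact ⟨F, ⟨hset, by rw [heq]; exact hM.2⟩, heq⟩

/-! ### Fundamental syzygies -/

theorem QSModule.IsMarkedBasis.exists_fundamentalSyzygy {F : X.P → X.ι → Poly n A}
    (hF : X.IsMarkedBasis F) (q : nextBasis X.P) :
    ∃ Q : X.P → Poly n A, X.IsMultiplicative Q ∧
      IsHomog X.next.d (termDegree X.next.d q.1) Q ∧
      X.boundary F (term A q.1) = X.boundary F Q := by
  obtain ⟨i, hi, hq⟩ := mem_nextBasis.1 q.2
  have e0 : X.boundary F (term A q.1) = (MvPolynomial.X i : Poly n A) • F q.1.1 := by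
    rw [X.boundary_term, hq]; rfl
  obtain ⟨Q, g, hQ, hQs, -, hg, -, e⟩ := mem_redSpan.1 (hF.1.X_smul_mem q.1.1 hi)
  have hg0 : g = 0 := hF.normalForm_eq_zero (Q := Q) hg (by
    rw [← e]; exact Submodule.smul_mem _ _ (X.mem_span_range F _))
  refine ⟨Q, hQ, ?_, by rw [e0, e, hg0, add_zero]⟩
  have hdeg : termDegree X.next.d q.1 = 1 + termDegree X.d q.1.1.1 := by
    simp [termDegree, hq]
  rw [hdeg]
  exact hQs

theorem QSModule.IsMarkedBasis.exists_isFundamentalSyzygies {F : X.P → X.ι → Poly n A}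
    (hF : X.IsMarkedBasis F) : ∃ G, X.IsFundamentalSyzygies F G := by
  choose Q h1 _ h2 using hF.exists_fundamentalSyzygy
  exact ⟨fun q => term A q.1 - Q q, fun q => ⟨Q q, h1 q, h2 q, rfl⟩⟩

theorem QSModule.IsMarkedSet.isFundamentalSyzygies_unique {F : X.P → X.ι → Poly n A}
    (hF : X.IsMarkedSet F) {G G' : nextBasis X.P → X.P → Poly n A}
    (hG : X.IsFundamentalSyzygies F G) (hG' : X.IsFundamentalSyzygies F G') : G = G' := by
  funext q
  obtain ⟨Q, hQ, h1, h2⟩ := hG q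
  obtain ⟨Q', hQ', h1', h2'⟩ := hG' q
  rw [h2, h2', (hF.unique (g := 0) (g' := 0) hQ (Submodule.zero_mem _) hQ' (Submodule.zero_mem _)
    (by rw [← h1, ← h1'])).1]

/-- A term `x^η f_c` lies in `U'` exactly when some variable of `x^η` is non-multiplicative for `c`.
Uniqueness of writings for `F` thus becomes directness of the sum for the syzygies. -/
theorem QSModule.isMultiplicative_iff_normalForms_next {Q : X.P → Poly n A} :
    X.IsMultiplicative Q ↔ Q ∈ X.next.normalForms A := by
  rw [mem_normalForms]
  have key : ∀ t : Term n X.P, term K t ∉ X.next.U ↔ ∀ j, t.2 j ≠ 0 → j ≤ minVar t.1.1.2 := by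
    intro t
    rw [term_mem_next]
    constructor
    · intro h j hj
      by_contra hlt
      exact h ⟨j, not_le.1 hlt, hj⟩
    · rintro h ⟨j, hlt, hj⟩
      exact absurd (h j hj) (not_le.2 hlt)
  exact ⟨fun h t ht => (key t).2 (h t.1 t.2 ht), fun h c η hη => (key (c, η)).1 (h (c, η) hη)⟩

/-- The fundamental syzygies of a `U`-marked basis are a `U'`-marked basis. -/
theorem QSModule.IsMarkedBasis.next {F : X.P → X.ι → Poly n A} (hF : X.IsMarkedBasis F)
    {G : nextBasis X.P → X.P → Poly n A} (hG : X.IsFundamentalSyzygies F G) :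
    X.next.IsMarkedBasis G := by
  have hset : X.next.IsMarkedSet G := by
    intro q
    obtain ⟨Q, hQ, h1, h2⟩ := hG q
    obtain ⟨Q', hQ', hQs, h1'⟩ := hF.exists_fundamentalSyzygy q
    -- Fundamental syzygies are defined without asking `Q` to be homogeneous; uniqueness identifies
    -- it with the homogeneous writing.
    obtain ⟨rfl, -⟩ := hF.1.unique (g := 0) (g' := 0) hQ (Submodule.zero_mem _) hQ'
      (Submodule.zero_mem _) (by rw [← h1, ← h1'])
    have hN := mem_normalForms.1 (isMultiplicative_iff_normalForms_next.1 hQ)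
    rw [h2]
    refine ⟨?_, ?_, fun t hta ht => ?_⟩
    · exact isHomog_iff.2 (Submodule.sub_mem _ (isHomog_iff.1 (isHomog_term X.next.d q.1))
        (isHomog_iff.1 hQs))
    · have h0 : MvPolynomial.coeff q.1.2 (Q q.1.1) = 0 := by
        by_contra h0
        exact hN q.1 h0 (X.next.basis_mem q)
      rw [Pi.sub_apply, MvPolynomial.coeff_sub, h0, coeff_term_self, sub_zero]
    · rw [Pi.sub_apply, MvPolynomial.coeff_sub, coeff_term_ne hta, zero_sub, neg_ne_zero] at ht
      exact hN t ht
  refine ⟨hset, ?_, ?_⟩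
  · rw [Submodule.disjoint_def]
    intro f hf hN
    have hle : Submodule.span (Poly n A) (Set.range G) ≤ X.syz F := by
      rw [Submodule.span_le]
      rintro _ ⟨q, rfl⟩
      obtain ⟨Q, -, h1, h2⟩ := hG q
      rw [h2]
      change X.boundary F _ = 0
      rw [map_sub, h1, sub_self]
    -- A syzygy with multiplicative coefficients vanishes by uniqueness. Only the inclusion of `(G)`
    -- in the syzygy module is needed.
    have h0 : X.boundary F f = 0 := hle hf
    exact (hF.1.eq_zero (g := 0) (isMultiplicative_iff_normalForms_next.2 hN)
      (Submodule.zero_mem _) (by rw [h0, add_zero])).1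
  · rw [codisjoint_iff, eq_top_iff, ← hset.sup_eq_top]
    exact sup_le_sup_right (X.next.multSpan_le G) _

/-! ### The projections -/

theorem QSModule.IsMarkedModule.exists_isSyzygyModule
    {M : Submodule (Poly n A) (X.ι → Poly n A)} (hM : X.IsMarkedModule M) :
    ∃ S, X.IsSyzygyModule M S := by
  obtain ⟨F, hF, h⟩ := hM.exists_basis
  exact ⟨_, F, hF, h, rfl⟩

theorem QSModule.IsSyzygyModule.unique {M : Submodule (Poly n A) (X.ι → Poly n A)}
    {S S' : Submodule (Poly n A) (X.P → Poly n A)} (h : X.IsSyzygyModule M S)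
    (h' : X.IsSyzygyModule M S') : S = S' := by
  obtain ⟨F, hF, rfl, rfl⟩ := h
  obtain ⟨F', hF', e, rfl⟩ := h'
  rw [hF.eq_of_span_eq hF' e.symm]

theorem QSModule.IsMarkedBasis.exists_resolution {F : X.P → X.ι → Poly n A}
    (hF : X.IsMarkedBasis F) :
    ∃ G : ∀ t : ℕ, (X.iter t).P → (X.iter t).ι → Poly n A,
      G 0 = F ∧ (∀ t, (X.iter t).IsMarkedBasis (G t)) ∧
      ∀ t, (X.iter t).IsFundamentalSyzygies (G t) (G (t + 1)) := by
  -- The recursion carries the marked-basis property, which each choice of fundamental syzygies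
  -- requires.
  let H : ∀ t : ℕ, {G : (X.iter t).P → (X.iter t).ι → Poly n A // (X.iter t).IsMarkedBasis G} :=
    fun t => Nat.rec ⟨F, hF⟩ (fun t G => ⟨G.2.exists_isFundamentalSyzygies.choose,
      G.2.next G.2.exists_isFundamentalSyzygies.choose_spec⟩) t
  exact ⟨fun t => (H t).1, rfl, fun t => (H t).2,
    fun t => (H t).2.exists_isFundamentalSyzygies.choose_spec⟩

theorem QSModule.IsMarkedModule.exists_isSyzygySequence
    {M : Submodule (Poly n A) (X.ι → Poly n A)} (hM : X.IsMarkedModule M) :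
    ∃ S, X.IsSyzygySequence M S := by
  obtain ⟨F, hF, h⟩ := hM.exists_basis
  obtain ⟨G, rfl, h1, h2⟩ := hF.exists_resolution
  exact ⟨_, G, h1, h, h2, fun _ => rfl⟩

theorem QSModule.IsSyzygySequence.unique {M : Submodule (Poly n A) (X.ι → Poly n A)}
    {S S' : ∀ t : Fin X.length, Submodule (Poly n A) ((X.iter t).P → Poly n A)}
    (h : X.IsSyzygySequence M S) (h' : X.IsSyzygySequence M S') : S = S' := by
  obtain ⟨F, hF, rfl, hfun, hS⟩ := h
  obtain ⟨F', hF', e, hfun', hS'⟩ := h'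
  have key : ∀ t, F t = F' t := by
    intro t
    induction t with
    | zero => exact (hF 0).eq_of_span_eq (hF' 0) e.symm
    | succ t ih =>
      have := hfun' t
      rw [← ih] at this
      exact (hF t).1.isFundamentalSyzygies_unique (hfun t) this
  funext t
  rw [hS, hS', key]

variable (X)

theorem QSModule.isIso_syzygyProj : IsIso X.syzygyProj := by
  refine (NatTrans.isIso_iff_isIso_app _).2 fun A => (isIso_iff_bijective _).2 ⟨?_, ?_⟩
  · rintro ⟨⟨M, S⟩, h1, h2⟩ ⟨⟨M', S'⟩, h1', h2'⟩ e
    obtain rfl : M = M' := congrArg Subtype.val e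
    exact Subtype.ext (Prod.ext rfl (h2.unique h2'))
  · rintro ⟨M, hM⟩
    obtain ⟨S, hS⟩ := hM.exists_isSyzygyModule
    exact ⟨⟨(M, S), hM, hS⟩, rfl⟩

theorem QSModule.isIso_resolutionProj : IsIso X.resolutionProj := by
  refine (NatTrans.isIso_iff_isIso_app _).2 fun A => (isIso_iff_bijective _).2 ⟨?_, ?_⟩
  · rintro ⟨⟨M, S⟩, h1, h2⟩ ⟨⟨M', S'⟩, h1', h2'⟩ e
    obtain rfl : M = M' := congrArg Subtype.val e
    exact Subtype.ext (Prod.ext rfl (h2.unique h2'))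
  · rintro ⟨M, hM⟩
    obtain ⟨S, hS⟩ := hM.exists_isSyzygySequence
    exact ⟨⟨(M, S), hM, hS⟩, rfl⟩

end MarkedModule

/-! ### The universal marked basis -/

section Universal

variable {K : Type u} [Field K] {n : ℕ} {X : QSModule K n} {A B : Type u} [CommRing A] [CommRing B]

theorem QSModule.IsMarkedSet.map (σ : A →+* B) {F : X.P → X.ι → Poly n A}
    (h : X.IsMarkedSet F) : X.IsMarkedSet fun a => mapVec σ (F a) := by
  refine fun a => ⟨fun t ht => (h a).1 t fun h0 => ht ?_, ?_,
    fun t hta ht => (h a).2.2 t hta fun h0 => ht ?_⟩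
  · simp only [mapVec, MvPolynomial.coeff_map, h0, map_zero]
  · simp only [mapVec, MvPolynomial.coeff_map, (h a).2.1, map_one]
  · simp only [mapVec, MvPolynomial.coeff_map, h0, map_zero]

theorem QSModule.IsMultiplicative.map (σ : A →+* B) {Q : X.P → Poly n A}
    (hQ : X.IsMultiplicative Q) : X.IsMultiplicative (mapVec σ Q) := fun c η hη =>
  hQ c η fun h0 => hη (by rw [mapVec, MvPolynomial.coeff_map, h0, map_zero])

variable (X)

theorem QSModule.coeff_genericSet_param (c : X.Param) :
    MvPolynomial.coeff c.1.2.2 (X.genericSet c.1.1 c.1.2.1) = -MvPolynomial.X c := by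
  classical
  have := Fintype.ofFinite {c' : X.Param // c'.1.1 = c.1.1}
  change termCoeff X.ParamRing c.1.2 (X.genericSet c.1.1) = _
  rw [genericSet, finsum_eq_sum_of_fintype, map_sub, map_sum, Finset.sum_eq_single ⟨c, rfl⟩]
  · rw [map_smul, termCoeff_apply, termCoeff_apply, coeff_term_self,
      coeff_term_ne fun e => c.2.1 (by rw [e]; exact X.basis_mem _), zero_sub, smul_eq_mul, mul_one]
  · rintro ⟨c', h⟩ _ hne
    rw [map_smul, termCoeff_apply, coeff_term_ne, smul_zero]
    intro e
    exact hne (Subtype.ext (Subtype.ext (Prod.ext h e.symm)))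
  · exact fun h => absurd (Finset.mem_univ _) h

theorem QSModule.isMarkedSet_genericSet : X.IsMarkedSet X.genericSet := by
  classical
  have key : ∀ a : X.P, X.genericSet a - term X.ParamRing a.1 ∈
      Submodule.span X.ParamRing (term X.ParamRing ''
        {t | term K t ∉ X.U ∧ termDegree X.d t = termDegree X.d a.1}) := by
    intro a
    have := Fintype.ofFinite {c : X.Param // c.1.1 = a}
    rw [genericSet, finsum_eq_sum_of_fintype, sub_sub_cancel_left]
    refine Submodule.neg_mem _ (Submodule.sum_mem _ ?_)
    rintro ⟨c, rfl⟩ _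
    exact Submodule.smul_mem _ _ (Submodule.subset_span ⟨c.1.2, c.2, rfl⟩)
  intro a
  have hc : ∀ t : Term n X.ι, t ≠ a.1 → MvPolynomial.coeff t.2 (X.genericSet a t.1) ≠ 0 →
      term K t ∉ X.U ∧ termDegree X.d t = termDegree X.d a.1 := by
    intro t hta ht
    refine mem_span_term.1 (key a) t ?_
    rwa [Pi.sub_apply, MvPolynomial.coeff_sub, coeff_term_ne hta, sub_zero]
  refine ⟨fun t ht => ?_, ?_, fun t hta ht => (hc t hta ht).1⟩
  · by_cases hta : t = a.1
    · rw [hta]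
    · exact (hc t hta ht).2
  · have h0 : MvPolynomial.coeff a.1.2 ((X.genericSet a - term X.ParamRing a.1) a.1.1) = 0 := by
      by_contra h0
      exact (mem_span_term.1 (key a) a.1 h0).1 (X.basis_mem a)
    rw [Pi.sub_apply, MvPolynomial.coeff_sub, coeff_term_self] at h0
    exact sub_eq_zero.1 h0

variable {X}

/-- The parameters index exactly the free coefficients: the head has coefficient `1`, and all others
vanish by marking or by degree. -/
theorem QSModule.IsMarkedSet.ext {F F' : X.P → X.ι → Poly n A} (hF : X.IsMarkedSet F)
    (hF' : X.IsMarkedSet F') (h : ∀ c : X.Param, MvPolynomial.coeff c.1.2.2 (F c.1.1 c.1.2.1) =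
      MvPolynomial.coeff c.1.2.2 (F' c.1.1 c.1.2.1)) : F = F' := by
  funext a
  refine vec_ext fun t => ?_
  by_cases hta : t = a.1
  · rw [hta, (hF a).2.1, (hF' a).2.1]
  by_cases hc : term K t ∉ X.U ∧ termDegree X.d t = termDegree X.d a.1
  · exact h ⟨(a, t), hc⟩
  · have h0 : ∀ {F : X.P → X.ι → Poly n A}, X.IsMarkedSet F →
        MvPolynomial.coeff t.2 (F a t.1) = 0 := fun {F} hF => by
      by_contra h0
      exact hc ⟨(hF a).2.2 t hta h0, (hF a).1 t h0⟩
    rw [h0 hF, h0 hF']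

theorem QSModule.IsMarkedSet.eq_map_genericSet {F : X.P → X.ι → Poly n A}
    (hF : X.IsMarkedSet F) (φ : X.ParamRing →+* A)
    (hφ : ∀ c : X.Param, φ (MvPolynomial.X c) =
      -MvPolynomial.coeff c.1.2.2 (F c.1.1 c.1.2.1)) :
    (fun a => mapVec φ (X.genericSet a)) = F := by
  refine (X.isMarkedSet_genericSet.map φ).ext hF fun c => ?_
  rw [mapVec, MvPolynomial.coeff_map, X.coeff_genericSet_param, map_neg, hφ, neg_neg]

theorem QSModule.map_X_smul (φ : X.ParamRing →+* A) {a : X.P} {i : Fin (n + 1)}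
    {Q : X.P → Poly n X.ParamRing} {g : X.ι → Poly n X.ParamRing}
    (h : (MvPolynomial.X i : Poly n X.ParamRing) • X.genericSet a =
      X.boundary X.genericSet Q + g) :
    (MvPolynomial.X i : Poly n A) • mapVec φ (X.genericSet a) =
      X.boundary (fun a => mapVec φ (X.genericSet a)) (mapVec φ Q) + mapVec φ g := by
  rw [boundary_map, ← mapVec_add, ← h, mapVec_smul, MvPolynomial.map_X]

/-- A specialization of the generic marked set is a marked basis if and only if the marked ideal
specializes to zero. -/
theorem QSModule.isMarkedBasis_map_genericSet_iff (φ : X.ParamRing →+* A) :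
    X.IsMarkedBasis (fun a => mapVec φ (X.genericSet a)) ↔ X.markedIdeal ≤ RingHom.ker φ := by
  constructor
  · intro h
    rw [markedIdeal, Ideal.span_le]
    rintro _ ⟨a, i, Q, g, -, -, hg, e, t, rfl⟩
    have e' := map_X_smul φ e
    have h0 : mapVec φ g = 0 := by
      refine h.normalForm_eq_zero (Q := mapVec φ Q) (mapVec_normalForms X φ hg) ?_
      rw [← e']
      exact Submodule.smul_mem _ _ (X.mem_span_range (fun a => mapVec φ (X.genericSet a)) a)
    change φ (MvPolynomial.coeff t.2 (g t.1)) = 0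
    rw [← MvPolynomial.coeff_map]
    change MvPolynomial.coeff t.2 (mapVec φ g t.1) = 0
    rw [h0]; simp
  · intro h
    refine (X.isMarkedSet_genericSet.map φ).isMarkedBasis fun a i hi => ?_
    obtain ⟨Q, g, hQ, hg, e⟩ := X.isMarkedSet_genericSet.exists_writing
      ((MvPolynomial.X i : Poly n X.ParamRing) • X.genericSet a)
    have hg0 : mapVec φ g = 0 := by
      refine vec_ext fun t => ?_
      rw [mapVec, MvPolynomial.coeff_map]
      have : MvPolynomial.coeff t.2 (g t.1) ∈ X.markedIdeal :=
        Ideal.subset_span ⟨a, i, Q, g, hi, hQ, hg, e, t, rfl⟩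
      simpa using h this
    refine mem_multSpan.2 ⟨mapVec φ Q, hQ.map φ, ?_⟩
    rw [map_X_smul φ e, hg0, add_zero]

variable (X)

instance QSModule.isNoetherianRing_quotient : IsNoetherianRing (X.ParamRing ⧸ X.markedIdeal) :=
  Ideal.Quotient.isNoetherianRing _

/-- The coordinate ring of the marked scheme. -/
noncomputable def QSModule.markedRing : NoethAlg K :=
  ⟨.of K (X.ParamRing ⧸ X.markedIdeal), X.isNoetherianRing_quotient⟩

/-- The universal marked basis. -/
noncomputable def QSModule.universalBasis (a : X.P) :
    X.ι → Poly n (X.ParamRing ⧸ X.markedIdeal) :=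
  mapVec (Ideal.Quotient.mk X.markedIdeal) (X.genericSet a)

theorem QSModule.isMarkedBasis_universalBasis : X.IsMarkedBasis X.universalBasis :=
  (isMarkedBasis_map_genericSet_iff _).2 (by rw [Ideal.mk_ker])

/-- The universal marked module. -/
noncomputable def QSModule.universalModule : X.markedFunctor.obj X.markedRing :=
  ⟨Submodule.span _ (Set.range X.universalBasis), X.isMarkedBasis_universalBasis.isMarkedModule⟩

/-- A module determines its marked basis, whose coefficients are, up to sign, the images of the
`C_a^b`; this gives injectivity. Conversely, the coefficients of the marked basis of `M` define a
specialization that kills the marked ideal. -/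
theorem QSModule.map_universalModule_bijective (A : NoethAlg K) :
    Function.Bijective fun σ : X.markedRing ⟶ A => X.markedFunctor.map σ X.universalModule := by
  have hmap : ∀ σ : X.markedRing ⟶ A, (X.markedFunctor.map σ X.universalModule).1 =
      Submodule.span (Poly n A.obj)
        (Set.range fun a => mapVec (NoethAlg.ringHom σ) (X.universalBasis a)) :=
    fun σ => extend_span_range X (NoethAlg.ringHom σ) X.universalBasis
  have hcomp : ∀ σ : X.markedRing ⟶ A,
      (fun a => mapVec (NoethAlg.ringHom σ) (X.universalBasis a)) =
      fun a => mapVec ((NoethAlg.ringHom σ).comp (Ideal.Quotient.mk X.markedIdeal))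
        (X.genericSet a) :=
    fun σ => funext fun a => (mapVec_comp _ _ _).symm
  constructor
  · intro σ τ h
    have h1 : Submodule.span (Poly n A.obj) _ = Submodule.span (Poly n A.obj) _ :=
      (hmap σ).symm.trans ((congrArg Subtype.val h).trans (hmap τ))
    have h2 := (isMarkedBasis_map X (NoethAlg.ringHom σ)
      X.isMarkedBasis_universalBasis).eq_of_span_eq
      (isMarkedBasis_map X (NoethAlg.ringHom τ) X.isMarkedBasis_universalBasis) h1
    rw [hcomp, hcomp] at h2
    refine ObjectProperty.hom_ext _ (CommAlgCat.hom_ext ?_)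
    refine Ideal.Quotient.algHom_ext K (MvPolynomial.algHom_ext fun c => ?_)
    have h3 := congrArg (MvPolynomial.coeff c.1.2.2) (congrFun (congrFun h2 c.1.1) c.1.2.1)
    simp only [mapVec, MvPolynomial.coeff_map, X.coeff_genericSet_param, map_neg, neg_inj] at h3
    exact h3
  · rintro ⟨M, hM⟩
    obtain ⟨F, hF, rfl⟩ := hM.exists_basis
    let φ : X.ParamRing →ₐ[K] A.obj := MvPolynomial.aeval fun c =>
      -MvPolynomial.coeff c.1.2.2 (F c.1.1 c.1.2.1)
    have hφ : (fun a => mapVec φ.toRingHom (X.genericSet a)) = F :=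
      hF.1.eq_map_genericSet φ.toRingHom fun c => MvPolynomial.aeval_X _ c
    have hker := (isMarkedBasis_map_genericSet_iff φ.toRingHom).1 (by rw [hφ]; exact hF)
    refine ⟨ObjectProperty.homMk (CommAlgCat.ofHom
      (Ideal.Quotient.liftₐ X.markedIdeal φ fun x hx => hker hx)), Subtype.ext ?_⟩
    refine (hmap _).trans ?_
    rw [hcomp]
    exact congrArg (fun G : X.P → X.ι → Poly n A.obj =>
      Submodule.span (Poly n A.obj) (Set.range G)) hφ

/-- The marked functor is corepresented by the coordinate ring of the marked scheme. -/
noncomputable def QSModule.corepresentableBy : X.markedFunctor.CorepresentableBy X.markedRing where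
  homEquiv {A} := Equiv.ofBijective _ (X.map_universalModule_bijective A)
  homEquiv_comp σ τ := by
    change X.markedFunctor.map (τ ≫ σ) _ = X.markedFunctor.map σ (X.markedFunctor.map τ _)
    rw [Functor.map_comp]; rfl

end Universal

/-! ### The functor of points of an affine scheme. -/

section Points

variable {K : Type u} [Field K]

instance algSpec_faithful : (algSpec (.of K)).Faithful := algSpec.instFaithful

instance algSpec_full : (algSpec (.of K)).Full := algSpec.instFull

/-- The functor of points of an affine scheme is corepresented by its coordinate ring. -/
noncomputable def pointsFunctorAlgSpecIso (R : NoethAlg K) :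
    coyoneda.obj (.op R) ≅ pointsFunctor ((algSpec (.of K)).obj (.op R.obj)) :=
  NatIso.ofComponents (fun A => (Equiv.ofBijective
    (fun σ : R ⟶ A => (algSpec (.of K)).map (σ.hom.op : Opposite.op A.obj ⟶ .op R.obj))
    ⟨fun σ τ h => ObjectProperty.hom_ext _
        (Quiver.Hom.op_inj ((algSpec (.of K)).map_injective h)),
      fun f => by
        obtain ⟨g, rfl⟩ := (algSpec (.of K)).map_surjective f
        exact ⟨ObjectProperty.homMk g.unop, rfl⟩⟩).toIso) fun {A B} σ => by
    refine ConcreteCategory.hom_ext _ _ fun τ => ?_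
    exact (algSpec (.of K)).map_comp (σ.hom.op : Opposite.op B.obj ⟶ .op A.obj) τ.hom.op

theorem represents_of_corepresentableBy {F : NoethAlg K ⥤ Type u} {R : NoethAlg K}
    (h : F.CorepresentableBy R) : Represents ((algSpec (.of K)).obj (.op R.obj)) F :=
  ⟨(pointsFunctorAlgSpecIso R).symm ≪≫ h.toIso⟩

end Points

/-! ### Locally Noetherian schemes and their points in Noetherian algebras -/

section Uniqueness

/-- A morphism `u : Z ⟶ Y` of locally Noetherian schemes which induces bijections on points with
values in Noetherian rings is an isomorphism. -/
theorem isIso_of_noetherian_points {Z Y : Scheme.{u}} [IsLocallyNoetherian Z]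
    [IsLocallyNoetherian Y] (p : Z ⟶ Y)
    (h : ∀ R : CommRingCat.{u}, IsNoetherianRing R →
      Function.Bijective fun g : Spec R ⟶ Z => g ≫ p) : IsIso p := by
  have hinj : ∀ (W : Scheme.{u}) [IsLocallyNoetherian W] (f g : W ⟶ Z),
      f ≫ p = g ≫ p → f = g := by
    intro W _ f g e
    refine Scheme.Cover.hom_ext W.affineCover f g fun i => ?_
    have h1 : IsLocallyNoetherian (W.affineCover.X i) := inferInstance
    refine (h _ (isLocallyNoetherian_Spec.1 h1)).1 ?_
    change (W.affineCover.f i ≫ f) ≫ p = (W.affineCover.f i ≫ g) ≫ p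
    rw [Category.assoc, Category.assoc, e]
  have hsurj : ∀ i : Y.affineCover.I₀, ∃ g : Y.affineCover.X i ⟶ Z, g ≫ p = Y.affineCover.f i := by
    intro i
    have h1 : IsLocallyNoetherian (Y.affineCover.X i) := inferInstance
    exact (h _ (isLocallyNoetherian_Spec.1 h1)).2 (Y.affineCover.f i)
  choose g hg using hsurj
  have hglue : ∀ x y, Limits.pullback.fst (Y.affineCover.f x) (Y.affineCover.f y) ≫ g x =
      Limits.pullback.snd _ _ ≫ g y := by
    intro x y
    -- Overlaps of charts need not be affine, which is why `hinj` is stated for every locally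
    -- Noetherian source.
    have := isLocallyNoetherian_of_isOpenImmersion
      (Limits.pullback.fst (Y.affineCover.f x) (Y.affineCover.f y))
    refine hinj _ _ _ ?_
    rw [Category.assoc, Category.assoc, hg, hg, Limits.pullback.condition]
  let q : Y ⟶ Z := Scheme.Cover.glueMorphisms Y.affineCover g hglue
  have hqp : q ≫ p = 𝟙 Y := by
    refine Scheme.Cover.hom_ext Y.affineCover _ _ fun i => ?_
    rw [← Category.assoc, Scheme.Cover.ι_glueMorphisms, hg, Category.comp_id]
  -- Both `p ≫ q` and the identity give `p` after composition with `p`, so `hinj` with source `Z`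
  -- identifies them.
  exact ⟨q, hinj _ _ _ (by rw [Category.assoc, hqp, Category.comp_id, Category.id_comp]), hqp⟩

variable {K : Type u} [Field K]

/-- A locally Noetherian scheme with the same points in Noetherian algebras as an affine
Noetherian scheme is isomorphic to it. -/
theorem nonempty_iso_of_pointsFunctor_iso (R : NoethAlg K) (Y : Over (Spec (.of K)))
    [IsLocallyNoetherian Y.left] (α : coyoneda.obj (.op R) ≅ pointsFunctor Y) :
    Nonempty (Y ≅ (algSpec (.of K)).obj (.op R.obj)) := by
  let Z := (algSpec (.of K)).obj (.op R.obj)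
  let p : Z ⟶ Y := α.hom.app R (𝟙 R)
  -- Yoneda: by naturality the isomorphism is composition with the image `p` of the identity.
  have hp : ∀ (A : NoethAlg K) (σ : R ⟶ A),
      α.hom.app A σ = (algSpec (.of K)).map (σ.hom.op : Opposite.op A.obj ⟶ .op R.obj) ≫ p := by
    intro A σ
    have h1 := ConcreteCategory.congr_hom (α.hom.naturality σ) (𝟙 R)
    have h2 : (coyoneda.obj (.op R)).map σ (𝟙 R) = σ := Category.id_comp σ
    change α.hom.app A ((coyoneda.obj (.op R)).map σ (𝟙 R)) = _ at h1
    rw [h2] at h1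
    exact h1
  have hbij : ∀ A : NoethAlg K, Function.Bijective
      fun f : (algSpec (.of K)).obj (.op A.obj) ⟶ Z => f ≫ p := by
    intro A
    have h1 : Function.Bijective (α.hom.app A) := (isIso_iff_bijective _).1 inferInstance
    constructor
    · intro f g e
      obtain ⟨f, rfl⟩ := (algSpec (.of K)).map_surjective f
      obtain ⟨g, rfl⟩ := (algSpec (.of K)).map_surjective g
      have h2 := h1.1 (((hp A (ObjectProperty.homMk f.unop)).trans e).trans
        (hp A (ObjectProperty.homMk g.unop)).symm)
      have h3 : f.unop = g.unop := congrArg (fun σ : R ⟶ A => σ.hom) h2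
      rw [Quiver.Hom.unop_inj h3]
    · intro f
      obtain ⟨σ, hσ⟩ := h1.2 f
      exact ⟨_, (hp A σ).symm.trans hσ⟩
  have hR : IsNoetherianRing R.obj := R.property
  have : IsLocallyNoetherian Z.left :=
    inferInstanceAs (IsLocallyNoetherian (Spec (.of R.obj)))
  have hiso : IsIso p.left := by
    refine isIso_of_noetherian_points p.left fun S hS => ?_
    -- Absolute points are reduced to points over `K`: a morphism from `Spec S` to `Z` or `Y` makes
    -- `S` a `K`-algebra through the structure morphism.
    have key : ∀ s : Spec S ⟶ Spec (.of K), Function.Bijective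
        fun f : Over.mk s ⟶ Z => f ≫ p := by
      intro s
      obtain ⟨φ, rfl⟩ := Spec.map_surjective s
      let _ : Algebra K S := φ.hom.toAlgebra
      exact hbij ⟨.of K S, hS⟩
    constructor
    · intro f g e
      have e : f ≫ p.left = g ≫ p.left := e
      have e' : f ≫ Z.hom = g ≫ Z.hom := by
        rw [← Over.w p, ← Category.assoc, e, Category.assoc]
      have := (key (g ≫ Z.hom)).1 (a₁ := Over.homMk f e') (a₂ := Over.homMk g rfl)
        (Over.OverMorphism.ext e)
      exact congrArg CommaMorphism.left this
    · intro f
      obtain ⟨g, hg⟩ := (key (f ≫ Y.hom)).2 (Over.homMk f rfl)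
      exact ⟨g.left, congrArg CommaMorphism.left hg⟩
  have : IsIso ((Over.forget _).map p) := hiso
  have : IsIso p := isIso_of_reflects_iso p (Over.forget _)
  exact ⟨(asIso p).symm⟩

end Uniqueness

/-! ### Representability and uniqueness for the marked scheme. -/

section MarkedScheme

variable {K : Type u} [Field K] {n : ℕ} (X : QSModule K n)

theorem QSModule.markedScheme_eq :
    X.markedScheme = (algSpec (.of K)).obj (.op X.markedRing.obj) := rfl

theorem QSModule.isLocallyNoetherian_markedScheme : IsLocallyNoetherian X.markedScheme.left :=
  inferInstanceAs (IsLocallyNoetherian (Spec (.of (X.ParamRing ⧸ X.markedIdeal))))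

theorem QSModule.represents_markedFunctor : Represents X.markedScheme X.markedFunctor := by
  rw [markedScheme_eq]
  exact represents_of_corepresentableBy X.corepresentableBy

theorem QSModule.nonempty_iso_markedScheme {F : NoethAlg K ⥤ Type u} (e : F ≅ X.markedFunctor)
    (Y : Over (Spec (.of K))) (hY : IsLocallyNoetherian Y.left) (h : Represents Y F) :
    Nonempty (Y ≅ X.markedScheme) := by
  obtain ⟨α⟩ := h
  rw [markedScheme_eq]
  exact nonempty_iso_of_pointsFunctor_iso X.markedRing Y
    (X.corepresentableBy.toIso ≪≫ (α ≪≫ e).symm)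

end MarkedScheme

end MarkedSyz

theorem mainTheorem7 {K : Type u} [Field K] {n m : ℕ} (d : Fin m → ℤ)
    (U : Submodule (MarkedSyz.Poly n K) (Fin m → MarkedSyz.Poly n K))
    (hU : MarkedSyz.IsQuasiStable U) :
    IsIso (hU.toQSModule d).syzygyProj ∧
    IsIso (hU.toQSModule d).resolutionProj ∧
    IsLocallyNoetherian (hU.toQSModule d).markedScheme.left ∧
    MarkedSyz.Represents (hU.toQSModule d).markedScheme (hU.toQSModule d).markedFunctor ∧
    (∃ Y : Over (Spec (.of K)), IsLocallyNoetherian Y.left ∧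
      MarkedSyz.Represents Y (hU.toQSModule d).syzygyFunctor) ∧
    (∃ Y : Over (Spec (.of K)), IsLocallyNoetherian Y.left ∧
      MarkedSyz.Represents Y (hU.toQSModule d).resolutionFunctor) ∧
    (∀ Y : Over (Spec (.of K)), IsLocallyNoetherian Y.left →
      MarkedSyz.Represents Y (hU.toQSModule d).syzygyFunctor →
        Nonempty (Y ≅ (hU.toQSModule d).markedScheme)) ∧
    (∀ Y : Over (Spec (.of K)), IsLocallyNoetherian Y.left →
      MarkedSyz.Represents Y (hU.toQSModule d).resolutionFunctor →
        Nonempty (Y ≅ (hU.toQSModule d).markedScheme)) := by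
  set X := hU.toQSModule d
  have hsyz : IsIso X.syzygyProj := X.isIso_syzygyProj
  have hres : IsIso X.resolutionProj := X.isIso_resolutionProj
  have hloc := X.isLocallyNoetherian_markedScheme
  have hrep := X.represents_markedFunctor
  exact ⟨hsyz, hres, hloc, hrep,
    ⟨_, hloc, hrep.map fun α => α ≪≫ (asIso X.syzygyProj).symm⟩,
    ⟨_, hloc, hrep.map fun α => α ≪≫ (asIso X.resolutionProj).symm⟩,
    X.nonempty_iso_markedScheme (asIso X.syzygyProj),
    X.nonempty_iso_markedScheme (asIso X.resolutionProj)⟩
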